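/- Let $0<s<1$, $\tau>0$, let $\omega\subset(-1,1)$ be measurable, $\varphi_0\in L^2(-1,1)$ and $\varepsilon>0$. Let $H_0^s(-1,1)$ be the space of all $u\in L^2(\mathbb R)$ with $u=0$ a.e. in $\mathbb R\setminus(-1,1)$ and $\iint_{\mathbb R^2}\frac{|u(x)-u(y)|^2}{|x-y|^{1+2s}}\,dx\,dy<\infty$, normed by $\|u\|^2=\|u\|_{L^2(\mathbb R)}^2+\iint_{\mathbb R^2}\frac{|u(x)-u(y)|^2}{|x-y|^{1+2s}}\,dx\,dy$, let $H^{-s}(-1,1)$ be its dual with pivot space $L^2(-1,1)$, and put $$\mathcal F(u,v)=\frac{C_s}{2}\iint_{\mathbb R^2}\frac{(u(x)-u(y))(v(x)-v(y))}{|x-y|^{1+2s}}\,dx\,dy,\qquad C_s=\frac{s2^{2s}\Gamma(\frac{2s+1}{2})}{\pi^{1/2}\Gamma(1-s)}.$$ For $\psi_0\in L^2(-1,1)$ and $h\in L^2(0,\tau;L^2(\omega))$, a finite-energy solution of $$-\partial_t\phi+(-\partial_x^2)^s\phi=h\chi_{\omega\times(0,\tau)}\ \text{in }(-1,1)\times(0,\tau),\qquad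 \phi=0\ \text{in }(\mathbb R\setminus(-1,1))\times(0,\tau),\qquad \phi(\cdot,\tau)=\psi_0$$ is a $\phi\in L^2(0,\tau;H_0^s(-1,1))$ that has a weak time derivative $\phi_t\in L^2(0,\tau;H^{-s}(-1,1))$ and a representative in $C([0,\tau];L^2(-1,1))$ with the value $\psi_0$ at $t=\tau$, and that satisfies $$-\int_0^\tau\langle\phi_t,w\rangle\,dt+\int_0^\tau\mathcal F(\phi,w)\,dt=\int_0^\tau\!\!\int_\omega h\,w\,dx\,dt\qquad\text{for all }w\in L^2(0,\tau;H_0^s(-1,1)).$$ Then for all such $\psi_0,h$ there is exactly one finite-energy solution, and its value $\phi(\cdot,0)\in L^2(-1,1)$ is well defined. Write $\phi_{h,\psi_0}$ for it, and put $Sh=\phi_{h,0}(\cdot,0)$, $z=-\phi_{0,\varphi_0}(\cdot,0)$. The reduced problem $$\min_{h\in L^2(0,\tau;L^2(\omega))}\ \frac12\|h\|_{L^2(0,\tau;L^2(\omega))}^2+\frac{\varepsilon}{2}\|Sh-z\|_{L^2(-1,1)}^2$$ has exactly one minimizer $\overline h_\varepsilon^{(\tau)}$, and $\overline h_\varepsilon^{(\tau)}$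 is also the one and only minimizer over $L^2(0,\tau;L^2(\omega))$ of the penalized HUM functional $$J_\varepsilon(h)=\frac12\|h\|_{L^2(0,\tau;L^2(\omega))}^2+\frac{\varepsilon}{2}\|\phi_{h,\varphi_0}(\cdot,0)\|_{L^2(-1,1)}^2 .$$ -/

import Mathlib

open MeasureTheory Set

namespace FracHUM

noncomputable section

/-! ### Fractional Sobolev space on the interval with zero exterior condition -/

/-- The space `L²(-1,1)`. -/
abbrev L2I : Type := Lp ℝ 2 (volume.restrict (Ioo (-1 : ℝ) 1))

/-- The difference quotient `(u(x) - u(y)) / |x - y|^((1+2s)/2)` on `ℝ × ℝ`. Its square is the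
Gagliardo integrand `|u(x) - u(y)|² / |x - y|^(1+2s)`. -/
def diffQuot (s : ℝ) (u : ℝ → ℝ) (p : ℝ × ℝ) : ℝ :=
  (u p.1 - u p.2) / |p.1 - p.2| ^ ((1 + 2 * s) / 2)

lemma diffQuot_mul (s : ℝ) (u v : ℝ → ℝ) (p : ℝ × ℝ) :
    diffQuot s u p * diffQuot s v p
      = (u p.1 - u p.2) * (v p.1 - v p.2) / |p.1 - p.2| ^ (1 + 2 * s) := by
  have h : |p.1 - p.2| ^ ((1 + 2 * s) / 2) * |p.1 - p.2| ^ ((1 + 2 * s) / 2)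
      = |p.1 - p.2| ^ (1 + 2 * s) := by
    rw [← pow_two, ← Real.rpow_natCast, ← Real.rpow_mul (abs_nonneg _)]
    norm_num
  unfold diffQuot
  rw [div_mul_div_comm, h]

/-- An almost everywhere identity in one variable holds almost everywhere in either variable
of the product. -/
lemma ae_prod_of_ae {P : ℝ → Prop} (h : ∀ᵐ x : ℝ, P x) : ∀ᵐ p : ℝ × ℝ, P p.1 ∧ P p.2 := by
  rw [Measure.volume_eq_prod]
  exact (Measure.quasiMeasurePreserving_fst.ae h).and (Measure.quasiMeasurePreserving_snd.ae h)

lemma diffQuot_add_ae (s : ℝ) (u v : Lp ℝ 2 (volume : Measure ℝ)) :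
    diffQuot s (u + v : Lp ℝ 2 (volume : Measure ℝ)) =ᵐ[volume] diffQuot s u + diffQuot s v := by
  filter_upwards [ae_prod_of_ae (Lp.coeFn_add u v)] with p hp
  simp only [diffQuot, Pi.add_apply, hp.1, hp.2]
  ring

lemma diffQuot_smul_ae (s c : ℝ) (u : Lp ℝ 2 (volume : Measure ℝ)) :
    diffQuot s (c • u : Lp ℝ 2 (volume : Measure ℝ)) =ᵐ[volume] c • diffQuot s u := by
  filter_upwards [ae_prod_of_ae (Lp.coeFn_smul c u)] with p hp
  simp only [diffQuot, Pi.smul_apply, smul_eq_mul, hp.1, hp.2]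
  ring

/-- `H₀ˢ(-1,1)` as a subspace of `L²(ℝ)`: the `u ∈ L²(ℝ)` that vanish almost everywhere outside
`(-1,1)` and have a finite Gagliardo integral
`∫∫ |u(x) - u(y)|² / |x - y|^(1+2s) dx dy` over `ℝ × ℝ`. -/
def hsZeroSubmodule (s : ℝ) : Submodule ℝ (Lp ℝ 2 (volume : Measure ℝ)) where
  carrier := {u | (∀ᵐ x : ℝ, x ∉ Ioo (-1 : ℝ) 1 → u x = 0) ∧
    MemLp (diffQuot s u) 2 (volume : Measure (ℝ × ℝ))}
  add_mem' := by
    rintro u v ⟨hu, hu'⟩ ⟨hv, hv'⟩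
    refine ⟨?_, (memLp_congr_ae (diffQuot_add_ae s u v)).2 (hu'.add hv')⟩
    filter_upwards [hu, hv, Lp.coeFn_add u v] with x h1 h2 h3 hx
    change (u + v : Lp ℝ 2 (volume : Measure ℝ)) x = 0
    rw [h3, Pi.add_apply, h1 hx, h2 hx, add_zero]
  zero_mem' := by
    constructor
    · filter_upwards [Lp.coeFn_zero ℝ 2 (volume : Measure ℝ)] with x hx _
      exact hx
    · refine (memLp_congr_ae ?_).2 (MemLp.zero' (ε := ℝ))
      filter_upwards [ae_prod_of_ae (Lp.coeFn_zero ℝ 2 (volume : Measure ℝ))] with p hp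
      simp only [diffQuot, hp.1, hp.2, Pi.zero_apply, sub_zero, zero_div]
  smul_mem' := by
    rintro c u ⟨hu, hu'⟩
    refine ⟨?_, (memLp_congr_ae (diffQuot_smul_ae s c u)).2 (hu'.const_smul c)⟩
    filter_upwards [hu, Lp.coeFn_smul c u] with x h1 h2 hx
    simp [h2, h1 hx]

/-- The space `H₀ˢ(-1,1)`. It is a copy of `hsZeroSubmodule s` that carries the `Hˢ` norm
(instances below) and not the norm of `L²(ℝ)`. -/
def HsZero (s : ℝ) : Type := hsZeroSubmodule s

instance (s : ℝ) : AddCommGroup (HsZero s) := inferInstanceAs (AddCommGroup (hsZeroSubmodule s))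
instance (s : ℝ) : Module ℝ (HsZero s) := inferInstanceAs (Module ℝ (hsZeroSubmodule s))

/-- The inclusion of `H₀ˢ(-1,1)` in `L²(ℝ)`, as a linear map. -/
def HsZero.incl (s : ℝ) : HsZero s →ₗ[ℝ] Lp ℝ 2 (volume : Measure ℝ) := (hsZeroSubmodule s).subtype

/-- An element of `H₀ˢ(-1,1)` is used as a function on `ℝ`. -/
instance (s : ℝ) : CoeFun (HsZero s) (fun _ => ℝ → ℝ) := ⟨fun u => (HsZero.incl s u : ℝ → ℝ)⟩

lemma HsZero.memLp_diffQuot {s : ℝ} (u : HsZero s) :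
    MemLp (diffQuot s u) 2 (volume : Measure (ℝ × ℝ)) := (show hsZeroSubmodule s from u).2.2

lemma HsZero.memLp {s : ℝ} (u : HsZero s) : MemLp u 2 (volume : Measure ℝ) :=
  Lp.memLp (HsZero.incl s u)

/-- The Gagliardo bilinear form
`∫∫ (u(x) - u(y)) (v(x) - v(y)) / |x - y|^(1+2s) dx dy` over `ℝ × ℝ`. -/
def gagliardo (s : ℝ) (u v : HsZero s) : ℝ :=
  ∫ p : ℝ × ℝ, (u p.1 - u p.2) * (v p.1 - v p.2) / |p.1 - p.2| ^ (1 + 2 * s)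

lemma gagliardo_eq (s : ℝ) (u v : HsZero s) :
    gagliardo s u v = ∫ p : ℝ × ℝ, diffQuot s u p * diffQuot s v p := by
  simp only [gagliardo, diffQuot_mul]

/-- The inner product `∫ u v + ∫∫ (u(x) - u(y)) (v(x) - v(y)) / |x - y|^(1+2s) dx dy`
of `H₀ˢ(-1,1)`. -/
@[reducible] def hsCore (s : ℝ) : InnerProductSpace.Core ℝ (HsZero s) where
  inner u v := (∫ x : ℝ, u x * v x) + gagliardo s u v
  conj_inner_symm u v := by
    simp only [gagliardo, conj_trivial]
    congr 1
    · exact integral_congr_ae (.of_forall fun x => by ring)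
    · exact integral_congr_ae (.of_forall fun p => by ring)
  re_inner_nonneg u := by
    simp only [gagliardo_eq, RCLike.re_to_real]
    exact add_nonneg (integral_nonneg fun x => mul_self_nonneg _)
      (integral_nonneg fun p => mul_self_nonneg _)
  add_left u v w := by
    have e1 : (∫ x : ℝ, (u + v) x * w x) = (∫ x : ℝ, u x * w x) + ∫ x : ℝ, v x * w x := by
      have i1 : Integrable fun x : ℝ => u x * w x := u.memLp.integrable_mul w.memLp
      have i2 : Integrable fun x : ℝ => v x * w x := v.memLp.integrable_mul w.memLp
      rw [← integral_add i1 i2]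
      apply integral_congr_ae
      rw [map_add]
      filter_upwards [Lp.coeFn_add (HsZero.incl s u) (HsZero.incl s v)] with x hx
      rw [hx, Pi.add_apply]
      ring
    have e2 : gagliardo s (u + v) w = gagliardo s u w + gagliardo s v w := by
      simp only [gagliardo_eq]
      have i1 : Integrable fun p : ℝ × ℝ => diffQuot s u p * diffQuot s w p :=
        u.memLp_diffQuot.integrable_mul w.memLp_diffQuot
      have i2 : Integrable fun p : ℝ × ℝ => diffQuot s v p * diffQuot s w p :=
        v.memLp_diffQuot.integrable_mul w.memLp_diffQuot
      rw [← integral_add i1 i2]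
      apply integral_congr_ae
      rw [map_add]
      filter_upwards [diffQuot_add_ae s (HsZero.incl s u) (HsZero.incl s v)] with x hx
      rw [hx, Pi.add_apply]
      ring
    simp only [e1, e2]
    ring
  smul_left u v c := by
    have e1 : (∫ x : ℝ, (c • u) x * v x) = c * ∫ x : ℝ, u x * v x := by
      rw [← integral_const_mul]
      apply integral_congr_ae
      rw [map_smul]
      filter_upwards [Lp.coeFn_smul c (HsZero.incl s u)] with x hx
      rw [hx, Pi.smul_apply, smul_eq_mul]
      ring
    have e2 : gagliardo s (c • u) v = c * gagliardo s u v := by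
      simp only [gagliardo_eq]
      rw [← integral_const_mul]
      apply integral_congr_ae
      rw [map_smul]
      filter_upwards [diffQuot_smul_ae s c (HsZero.incl s u)] with x hx
      rw [hx, Pi.smul_apply, smul_eq_mul]
      ring
    simp only [e1, e2, conj_trivial]
    ring
  definite u hu := by
    have h1 : 0 ≤ ∫ x : ℝ, u x * u x := integral_nonneg fun x => mul_self_nonneg _
    have h2 : 0 ≤ gagliardo s u u := by
      rw [gagliardo_eq]
      exact integral_nonneg fun p => mul_self_nonneg _
    have h3 : ∫ x : ℝ, u x * u x = 0 := le_antisymm (by linarith) h1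
    rw [integral_eq_zero_iff_of_nonneg (fun x => mul_self_nonneg _)
      (u.memLp.integrable_mul u.memLp)] at h3
    have h4 : HsZero.incl s u = 0 := by
      rw [Lp.eq_zero_iff_ae_eq_zero]
      filter_upwards [h3] with x hx
      exact mul_self_eq_zero.1 hx
    exact Subtype.ext h4

instance (s : ℝ) : NormedAddCommGroup (HsZero s) := (hsCore s).toNormedAddCommGroup
instance (s : ℝ) : InnerProductSpace ℝ (HsZero s) := InnerProductSpace.ofCore (hsCore s).toCore

lemma HsZero.inner_def {s : ℝ} (u v : HsZero s) :
    inner ℝ u v = (∫ x : ℝ, u x * v x) + gagliardo s u v := rfl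

lemma HsZero.norm_incl_le {s : ℝ} (u : HsZero s) : ‖HsZero.incl s u‖ ≤ ‖u‖ := by
  have h : ‖u‖ ^ 2 = ‖HsZero.incl s u‖ ^ 2 + gagliardo s u u := by
    rw [← real_inner_self_eq_norm_sq u, ← real_inner_self_eq_norm_sq (HsZero.incl s u),
      HsZero.inner_def, L2.inner_def]
    rfl
  have h2 : 0 ≤ gagliardo s u u := by
    rw [gagliardo_eq]
    exact integral_nonneg fun p => mul_self_nonneg _
  exact le_of_sq_le_sq (by linarith) (norm_nonneg u)

/-- The embedding of `H₀ˢ(-1,1)` in `L²(-1,1)`: restriction of functions to `(-1,1)`. -/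
def HsZero.toL2 (s : ℝ) : HsZero s →L[ℝ] L2I :=
  (LpToLpRestrictCLM ℝ ℝ ℝ (volume : Measure ℝ) 2 (Ioo (-1) 1)).comp
    ((HsZero.incl s).mkContinuous 1 fun u => by simpa using u.norm_incl_le)

/-- The space `H⁻ˢ(-1,1)`, the dual of `H₀ˢ(-1,1)`. -/
abbrev HsDual (s : ℝ) : Type := StrongDual ℝ (HsZero s)

/-- The embedding of the pivot space `L²(-1,1)` in `H⁻ˢ(-1,1)`: `f ↦ (v ↦ (f, v))`. -/
def pivot (s : ℝ) (f : L2I) : HsDual s := (innerSL ℝ f).comp (HsZero.toL2 s)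

/-- The normalization constant of the fractional Laplacian in dimension one. -/
def fracConst (s : ℝ) : ℝ :=
  s * 2 ^ (2 * s) * Real.Gamma ((2 * s + 1) / 2) / (Real.pi ^ (1 / 2 : ℝ) * Real.Gamma (1 - s))

/-- The bilinear form of the fractional Laplacian with zero exterior condition. -/
def fracForm (s : ℝ) (u v : HsZero s) : ℝ := fracConst s / 2 * gagliardo s u v

/-! ### The controlled backward fractional heat equation -/

/-- The Bochner space `L²(0,τ;E)`. -/
abbrev L2Time (τ : ℝ) (E : Type) [NormedAddCommGroup E] : Type :=
  Lp E 2 (volume.restrict (Ioo 0 τ))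

/-- The space `L²(0,τ;L²(ω))` of controls. -/
abbrev Control (τ : ℝ) (ω : Set ℝ) : Type := L2Time τ (Lp ℝ 2 (volume.restrict ω))

/-- `g ∈ L²(0,τ;H⁻ˢ(-1,1))` is the weak time derivative of `φ ∈ L²(0,τ;H₀ˢ(-1,1))`; the integrals
are Bochner integrals in `H⁻ˢ(-1,1)`. -/
def IsTimeDeriv (s τ : ℝ) (φ : L2Time τ (HsZero s)) (g : L2Time τ (HsDual s)) : Prop :=
  ∀ η : ℝ → ℝ, ContDiff ℝ (⊤ : ℕ∞) η → HasCompactSupport η → tsupport η ⊆ Ioo 0 τ →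
    ∫ t in Ioo 0 τ, deriv η t • pivot s (HsZero.toL2 s (φ t)) = - ∫ t in Ioo 0 τ, η t • g t

/-- `φ(·,t) = v`: the class `φ` has a representative in `C([0,τ];L²(-1,1))`, whose value at the
time `t ∈ [0,τ]` is `v`. -/
def HasTrace (s τ : ℝ) (φ : L2Time τ (HsZero s)) (t : ℝ) (v : L2I) : Prop :=
  ∃ y : ℝ → L2I, ContinuousOn y (Icc 0 τ) ∧
    (∀ᵐ r ∂(volume.restrict (Ioo 0 τ)), y r = HsZero.toL2 s (φ r)) ∧ y t = v

/-- `φ` is the finite-energy solution of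
`-∂ₜφ + (-∂ₓ²)ˢ φ = h χ_{ω × (0,τ)}` in `(-1,1) × (0,τ)`, `φ = 0` outside `(-1,1)`,
`φ(·,τ) = φ₀`. -/
def IsState (s τ : ℝ) (ω : Set ℝ) (φ₀ : L2I) (h : Control τ ω) (φ : L2Time τ (HsZero s)) : Prop :=
  (∃ g : L2Time τ (HsDual s), IsTimeDeriv s τ φ g ∧
    ∀ w : L2Time τ (HsZero s),
      -(∫ t in Ioo 0 τ, (g t) (w t)) + ∫ t in Ioo 0 τ, fracForm s (φ t) (w t)
        = ∫ t in Ioo 0 τ, ∫ x in ω, (h t) x * (w t) x) ∧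
  HasTrace s τ φ τ φ₀

/-- The solution mapping `(h, φ₀) ↦ φ` (meaningful when there is exactly one state). -/
def state (s τ : ℝ) (ω : Set ℝ) (φ₀ : L2I) (h : Control τ ω) : L2Time τ (HsZero s) :=
  Classical.epsilon fun φ => IsState s τ ω φ₀ h φ

/-- The observation `φ ↦ φ(·,0)` (meaningful when `φ` has a trace at time `0`). -/
def traceZero (s τ : ℝ) (φ : L2Time τ (HsZero s)) : L2I :=
  Classical.epsilon fun v => HasTrace s τ φ 0 v

/-- The penalized functional `½ ‖h‖² + (ε/2) ‖φ(·,0)‖²`, where `φ` is the state of `h`. -/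
def J (s τ : ℝ) (ω : Set ℝ) (φ₀ : L2I) (ε : ℝ) (h : Control τ ω) : ℝ :=
  1 / 2 * ‖h‖ ^ 2 + ε / 2 * ‖traceZero s τ (state s τ ω φ₀ h)‖ ^ 2

/-- `S h = φ(·,0)`, where `φ` is the state of `h` for zero terminal datum. -/
def controlToTrace (s τ : ℝ) (ω : Set ℝ) (h : Control τ ω) : L2I :=
  traceZero s τ (state s τ ω 0 h)

/-- The target `z = -φ(·,0)`, where `φ` is the uncontrolled state with terminal datum `φ₀`. -/
def target (s τ : ℝ) (ω : Set ℝ) (φ₀ : L2I) : L2I :=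
  -traceZero s τ (state s τ ω φ₀ 0)

/-- The reduced functional `½ ‖h‖² + (ε/2) ‖S h - z‖²`. -/
def reducedJ (s τ : ℝ) (ω : Set ℝ) (φ₀ : L2I) (ε : ℝ) (h : Control τ ω) : ℝ :=
  1 / 2 * ‖h‖ ^ 2 + ε / 2 * ‖controlToTrace s τ ω h - target s τ ω φ₀‖ ^ 2

end

end FracHUM

/-!
The embedding `j` of `H₀ˢ(-1,1)` in `L²(-1,1)` is compact with dense range, and the form of the
fractional Laplacian is a multiple of the difference of the inner products of the two spaces. Hence
the eigenvectors of the compact operator `j ∘ j†` on `L²(-1,1)` form a Hilbert basis that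
diagonalizes the form (`HsZero.exists_eigenBasis`), with nonnegative eigenvalues `λ k`. Compactness
comes from a Poincaré inequality on small cells: piecewise averages approximate a function with an
error of the order of the `s`-th power of the cell length (`HsZero.norm_sub_cellProj_sq_le`).
Density holds since smooth functions with compact support have a finite Gagliardo integral.

Along the basis the equation decouples into the scalar equations `-c' + λ c = f`. For uniqueness
(`eqOn_evol_of_isState`), test functions of the form `η(t) v k` show that the coefficients of any
continuous representative of a state satisfy these equations weakly, and the Du Bois-Reymond lemma
then identifies them with Duhamel's formula, so that no energy identity for the time derivative in
the dual space is needed. For existence (`isState_sol`), the scalar energy estimates make the series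
of Duhamel solutions converge in `L²(0,τ;H₀ˢ)` and, uniformly in time, in `L²(-1,1)`.

In consequence the value of a state at time `0` depends linearly and continuously on the data. The
reduced functional is thus a Tikhonov functional of the continuous linear map `S`, whose only
minimizer solves the normal equation (`exists_unique_minimizer`); by superposition
`φ(·,0) = S h - z`, so the penalized functional is the same function of the control.
-/

open MeasureTheory Set

namespace FracHUM

noncomputable section

/-! ### Scalar evolution equations -/

/-- A smooth function on `(0, τ)` with compact support and vanishing mean has a smooth compactly
supported primitive. -/
lemma exists_primitive_of_integral_eq_zero {τ : ℝ} (hτ : 0 < τ) {θ : ℝ → ℝ}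
    (hθ : ContDiff ℝ (⊤ : ℕ∞) θ) (hc : HasCompactSupport θ) (hs : tsupport θ ⊆ Ioo 0 τ)
    (h0 : ∫ t in Ioo 0 τ, θ t = 0) :
    ∃ η : ℝ → ℝ, ContDiff ℝ (⊤ : ℕ∞) η ∧ HasCompactSupport η ∧ tsupport η ⊆ Ioo 0 τ ∧
      deriv η = θ := by
  obtain ⟨a, b, ha, hb, hab, hsub⟩ : ∃ a b, 0 < a ∧ b < τ ∧ a ≤ b ∧ tsupport θ ⊆ Icc a b := by
    rcases (tsupport θ).eq_empty_or_nonempty with h | h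
    · exact ⟨τ / 2, τ / 2, by linarith, by linarith, le_rfl, by simp [h]⟩
    · obtain ⟨a, ha⟩ := hc.isCompact.exists_isLeast h
      obtain ⟨b, hb⟩ := hc.isCompact.exists_isGreatest h
      exact ⟨a, b, (hs ha.1).1, (hs hb.1).2, ha.2 hb.1, fun x hx => ⟨ha.2 hx, hb.2 hx⟩⟩
  have hz : ∀ x, x ∉ Icc a b → θ x = 0 := fun x hx =>
    image_eq_zero_of_notMem_tsupport fun h => hx (hsub h)
  have hi : ∀ x y : ℝ, IntervalIntegrable θ volume x y := fun x y =>
    hθ.continuous.intervalIntegrable x y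
  set η : ℝ → ℝ := fun t => ∫ r in (0 : ℝ)..t, θ r with hη
  have hd : ∀ t, HasDerivAt η (θ t) t := fun t =>
    intervalIntegral.integral_hasDerivAt_right (hi 0 t)
      hθ.continuous.stronglyMeasurable.stronglyMeasurableAtFilter hθ.continuous.continuousAt
  have hderiv : deriv η = θ := funext fun t => (hd t).deriv
  have hle : ∀ t, t < a → η t = 0 := fun t ht => by
    apply intervalIntegral.integral_zero_ae
    refine Filter.Eventually.of_forall fun x hx => hz x fun hx' => ?_
    rcases le_total 0 t with h | h
    · rw [uIoc_of_le h] at hx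
      linarith [hx.2, hx'.1]
    · rw [uIoc_of_ge h] at hx
      linarith [hx.2, hx'.1]
  have hτ0 : η τ = 0 := by
    rw [hη]
    simp only
    rw [intervalIntegral.integral_of_le hτ.le, integral_Ioc_eq_integral_Ioo, h0]
  have hge : ∀ t, b < t → η t = 0 := fun t ht => by
    have h1 : η τ + ∫ r in τ..t, θ r = η t :=
      intervalIntegral.integral_add_adjacent_intervals (hi _ _) (hi _ _)
    rw [← h1, hτ0, zero_add]
    apply intervalIntegral.integral_zero_ae
    refine Filter.Eventually.of_forall fun x hx => hz x fun hx' => ?_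
    rcases le_total τ t with h | h
    · rw [uIoc_of_le h] at hx
      linarith [hx.1, hx'.2]
    · rw [uIoc_of_ge h] at hx
      linarith [hx.1, hx'.2]
  have hts : tsupport η ⊆ Icc a b := by
    refine closure_minimal (fun x hx => ?_) isClosed_Icc
    by_contra h
    rw [mem_Icc, not_and_or, not_le, not_le] at h
    exact hx (h.elim (hle x) (hge x))
  refine ⟨η, ?_, isCompact_Icc.of_isClosed_subset (isClosed_tsupport η) hts,
    hts.trans fun x hx => ⟨ha.trans_le hx.1, hx.2.trans_lt hb⟩, hderiv⟩
  rw [contDiff_infty_iff_deriv]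
  exact ⟨fun t => (hd t).differentiableAt, by rw [hderiv]; exact hθ⟩

/-- Du Bois-Reymond: a continuous function with vanishing weak derivative is constant. -/
lemma eqOn_const_of_weakDeriv_eq_zero {τ : ℝ} (hτ : 0 < τ) {d : ℝ → ℝ}
    (hd : ContinuousOn d (Icc 0 τ))
    (h : ∀ η : ℝ → ℝ, ContDiff ℝ (⊤ : ℕ∞) η → HasCompactSupport η → tsupport η ⊆ Ioo 0 τ →
      ∫ t in Ioo 0 τ, deriv η t * d t = 0) :
    ∃ C, EqOn d (fun _ => C) (Icc 0 τ) := by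
  have hdi : IntegrableOn d (Ioo 0 τ) :=
    (hd.integrableOn_compact isCompact_Icc).mono_set Ioo_subset_Icc_self
  let B : ContDiffBump (τ / 2) := ⟨τ / 8, τ / 4, by linarith, by linarith⟩
  have hBs : tsupport (B.normed volume) ⊆ Ioo 0 τ := by
    rw [B.tsupport_normed_eq, Real.closedBall_eq_Icc]
    intro x hx
    change τ / 2 - τ / 4 ≤ x ∧ x ≤ τ / 2 + τ / 4 at hx
    constructor <;> linarith [hx.1, hx.2]
  have hBz : ∀ x, x ∉ Ioo 0 τ → B.normed volume x = 0 := fun x hx =>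
    image_eq_zero_of_notMem_tsupport fun h => hx (hBs h)
  have hB1 : ∫ t in Ioo 0 τ, B.normed volume t = 1 := by
    rw [setIntegral_eq_integral_of_forall_compl_eq_zero hBz, B.integral_normed]
  have hBd : ContDiff ℝ (⊤ : ℕ∞) (B.normed volume) := B.contDiff_normed
  set C : ℝ := ∫ t in Ioo 0 τ, B.normed volume t * d t with hC
  have hmul : ∀ θ : ℝ → ℝ, Continuous θ → IntegrableOn (fun t => θ t * d t) (Ioo 0 τ) :=
    fun θ hθ => ((hθ.continuousOn.mul hd).integrableOn_compact isCompact_Icc).mono_set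
      Ioo_subset_Icc_self
  have hci : ∀ θ : ℝ → ℝ, Continuous θ → IntegrableOn θ (Ioo 0 τ) := fun θ hθ =>
    (hθ.continuousOn.integrableOn_compact isCompact_Icc).mono_set Ioo_subset_Icc_self
  have key : ∀ᵐ x : ℝ, x ∈ Ioo 0 τ → d x - C = 0 := by
    refine isOpen_Ioo.ae_eq_zero_of_integral_contDiff_smul_eq_zero
      ((hdi.sub (integrableOn_const (by simp) (by simp))).locallyIntegrableOn) fun θ h1 h2 h3 => ?_
    have hz : ∀ x, x ∉ Ioo 0 τ → θ x • (d x - C) = 0 := fun x hx => by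
      rw [image_eq_zero_of_notMem_tsupport fun h => hx (h3 h), zero_smul]
    rw [← setIntegral_eq_integral_of_forall_compl_eq_zero hz]
    set m : ℝ := ∫ t in Ioo 0 τ, θ t with hm
    have hsupp : tsupport (fun t => θ t - m * B.normed volume t) ⊆ Ioo 0 τ := by
      refine (tsupport_sub _ _).trans (union_subset h3 ?_)
      exact (tsupport_mul_subset_right (f := fun _ => m)).trans hBs
    -- Subtracting a multiple of the bump makes the mean of `θ` vanish.
    obtain ⟨η, e1, e2, e3, e4⟩ := exists_primitive_of_integral_eq_zero hτ
      (θ := fun t => θ t - m * B.normed volume t) (h1.sub (contDiff_const.mul hBd))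
      (h2.sub (B.hasCompactSupport_normed.mul_left (f := fun _ => m))) hsupp (by
        rw [integral_sub (hci _ h1.continuous) ((hci _ hBd.continuous).const_mul m),
          integral_const_mul, hB1, mul_one, sub_self])
    have e5 := h η e1 e2 e3
    rw [e4] at e5
    have e6 : ∫ t in Ioo 0 τ, (θ t - m * B.normed volume t) * d t
        = (∫ t in Ioo 0 τ, θ t * d t) - m * C := by
      rw [hC, ← integral_const_mul, ← integral_sub (hmul _ h1.continuous)
        ((hmul _ hBd.continuous).const_mul m)]
      exact integral_congr_ae (.of_forall fun t => by simp only; ring)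
    have e7 : ∫ t in Ioo 0 τ, θ t • (d t - C) = (∫ t in Ioo 0 τ, θ t * d t) - m * C := by
      rw [hm, ← integral_mul_const, ← integral_sub (hmul _ h1.continuous)
        ((hci _ h1.continuous).mul_const C)]
      exact integral_congr_ae (.of_forall fun t => by simp only [smul_eq_mul]; ring)
    rw [e7, ← e6, e5]
  refine ⟨C, Measure.eqOn_Icc_of_ae_eq volume hτ.ne ?_ hd continuousOn_const⟩
  rw [← restrict_Ioo_eq_restrict_Icc, Filter.EventuallyEq, ae_restrict_iff' measurableSet_Ioo]
  filter_upwards [key] with x hx hx'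
  exact sub_eq_zero.1 (hx hx')

/-- The weak form of `d' = lam * d` together with `d τ = 0` forces `d = 0`: the function
`exp (-lam * t) * d t` has vanishing weak derivative. -/
lemma eqOn_zero_of_weakDeriv_eq {τ lam : ℝ} (hτ : 0 < τ) {d : ℝ → ℝ}
    (hd : ContinuousOn d (Icc 0 τ)) (hend : d τ = 0)
    (h : ∀ η : ℝ → ℝ, ContDiff ℝ (⊤ : ℕ∞) η → HasCompactSupport η → tsupport η ⊆ Ioo 0 τ →
      ∫ t in Ioo 0 τ, deriv η t * d t = - ∫ t in Ioo 0 τ, η t * (lam * d t)) :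
    EqOn d 0 (Icc 0 τ) := by
  have he : ContDiff ℝ (⊤ : ℕ∞) fun t : ℝ => Real.exp (-lam * t) :=
    (contDiff_const.mul contDiff_id).exp
  have hmul : ∀ θ : ℝ → ℝ, Continuous θ → IntegrableOn (fun t => θ t * d t) (Ioo 0 τ) :=
    fun θ hθ => ((hθ.continuousOn.mul hd).integrableOn_compact isCompact_Icc).mono_set
      Ioo_subset_Icc_self
  obtain ⟨C, hC⟩ := eqOn_const_of_weakDeriv_eq_zero hτ (d := fun t => Real.exp (-lam * t) * d t)
    (he.continuous.continuousOn.mul hd) fun η h1 h2 h3 => by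
      have e := h (fun t => Real.exp (-lam * t) * η t) (he.mul h1) (h2.mul_left)
        ((tsupport_mul_subset_right).trans h3)
      have hder : ∀ t, deriv (fun t => Real.exp (-lam * t) * η t) t
          = Real.exp (-lam * t) * deriv η t - lam * (Real.exp (-lam * t) * η t) := fun t => by
        have a1 : HasDerivAt (fun t => Real.exp (-lam * t)) (Real.exp (-lam * t) * (-lam)) t := by
          simpa using ((hasDerivAt_id t).const_mul (-lam)).exp
        have a2 := (h1.differentiable (by simp) t).hasDerivAt
        exact (a1.mul a2).deriv.trans (by ring)
      have i1 : IntegrableOn (fun t => Real.exp (-lam * t) * deriv η t * d t) (Ioo 0 τ) :=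
        hmul _ (he.continuous.mul (h1.continuous_deriv (by simp)))
      have i2 : IntegrableOn (fun t => Real.exp (-lam * t) * η t * (lam * d t)) (Ioo 0 τ) := by
        refine (hmul (fun t => Real.exp (-lam * t) * η t * lam)
          ((he.continuous.mul h1.continuous).mul continuous_const)).congr_fun (fun t _ => ?_)
          measurableSet_Ioo
        simp only [mul_assoc]
      have e8 : ∫ t in Ioo 0 τ, deriv (fun t => Real.exp (-lam * t) * η t) t * d t
          = (∫ t in Ioo 0 τ, Real.exp (-lam * t) * deriv η t * d t)
            - ∫ t in Ioo 0 τ, Real.exp (-lam * t) * η t * (lam * d t) := by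
        rw [← integral_sub i1 i2]
        exact integral_congr_ae (.of_forall fun t => by simp only [hder]; ring)
      have e9 : ∫ t in Ioo 0 τ, Real.exp (-lam * t) * deriv η t * d t = 0 := by linarith
      refine Eq.trans (integral_congr_ae (.of_forall fun t => ?_)) e9
      simp only
      ring
  intro t ht
  have h1 := hC ht
  have h2 := hC (right_mem_Icc.2 hτ.le)
  simp only [hend, mul_zero] at h1 h2
  rw [← h2] at h1
  exact (mul_eq_zero.1 h1).resolve_left (Real.exp_ne_zero _)

/-- The solution `c` of `-c' + lam * c = f` on `(0, τ)` with `c τ = ψ`, by Duhamel's formula. -/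
def duhamel (lam τ ψ : ℝ) (f : ℝ → ℝ) (t : ℝ) : ℝ :=
  Real.exp (-lam * (τ - t)) * ψ + Real.exp (lam * t) * ∫ r in t..τ, Real.exp (-lam * r) * f r

lemma duhamel_end (lam τ ψ : ℝ) (f : ℝ → ℝ) : duhamel lam τ ψ f τ = ψ := by
  simp [duhamel]

section Duhamel

variable {lam τ : ℝ} {f : ℝ → ℝ}

lemma intervalIntegrable_of_memLp (hτ : 0 < τ)
    (hf : MemLp f 2 (volume.restrict (Ioo 0 τ))) : IntervalIntegrable f volume 0 τ := by
  rw [intervalIntegrable_iff_integrableOn_Ioo_of_le hτ.le]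
  exact hf.integrable (by norm_num)

lemma intervalIntegrable_exp_mul (lam : ℝ) (hτ : 0 < τ)
    (hf : MemLp f 2 (volume.restrict (Ioo 0 τ))) :
    IntervalIntegrable (fun r => Real.exp (-lam * r) * f r) volume 0 τ :=
  (intervalIntegrable_of_memLp hτ hf).continuousOn_mul (by fun_prop)

lemma absolutelyContinuousOnInterval_duhamel (lam ψ : ℝ) (hτ : 0 < τ)
    (hf : MemLp f 2 (volume.restrict (Ioo 0 τ))) :
    AbsolutelyContinuousOnInterval (duhamel lam τ ψ f) 0 τ := by
  have h1 : AbsolutelyContinuousOnInterval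
      (fun t => ∫ r in τ..t, Real.exp (-lam * r) * f r) 0 τ :=
    (intervalIntegrable_exp_mul lam hτ hf).absolutelyContinuousOnInterval_intervalIntegral (by simp)
  have h2 : AbsolutelyContinuousOnInterval (fun t : ℝ => Real.exp (-lam * (τ - t)) * ψ) 0 τ :=
    ContDiffOn.absolutelyContinuousOnInterval (by fun_prop)
  have h3 : AbsolutelyContinuousOnInterval (fun t : ℝ => -Real.exp (lam * t)) 0 τ :=
    ContDiffOn.absolutelyContinuousOnInterval (by fun_prop)
  have h4 : duhamel lam τ ψ f = (fun t => Real.exp (-lam * (τ - t)) * ψ) +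
      (fun t => -Real.exp (lam * t)) * fun t => ∫ r in τ..t, Real.exp (-lam * r) * f r := by
    funext t
    simp only [duhamel, Pi.add_apply, Pi.mul_apply]
    rw [intervalIntegral.integral_symm]
    ring
  rw [h4]
  exact h2.add (h3.mul h1)

lemma ae_deriv_duhamel (lam ψ : ℝ) (hτ : 0 < τ)
    (hf : MemLp f 2 (volume.restrict (Ioo 0 τ))) :
    ∀ᵐ t, t ∈ Ioo 0 τ →
      deriv (duhamel lam τ ψ f) t = lam * duhamel lam τ ψ f t - f t := by
  filter_upwards [(intervalIntegrable_exp_mul lam hτ hf).ae_hasDerivAt_integral] with t ht ht'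
  have ht2 : t ∈ uIcc 0 τ := by
    rw [uIcc_of_le hτ.le]
    exact Ioo_subset_Icc_self ht'
  have h1 := ht ht2 τ (by simp)
  have h2 : HasDerivAt (fun t => Real.exp (-lam * (τ - t)) * ψ)
      (lam * (Real.exp (-lam * (τ - t)) * ψ)) t := by
    have := ((((hasDerivAt_id t).const_sub τ).const_mul (-lam)).exp).mul_const ψ
    refine this.congr_deriv ?_
    simp only [id]
    ring
  have h3 : HasDerivAt (fun t => Real.exp (lam * t)) (Real.exp (lam * t) * lam) t := by
    simpa using ((hasDerivAt_id t).const_mul lam).exp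
  have h4 := h2.sub (h3.mul h1)
  have h5 : duhamel lam τ ψ f = (fun t => Real.exp (-lam * (τ - t)) * ψ) -
      (fun t => Real.exp (lam * t)) * fun t => ∫ r in τ..t, Real.exp (-lam * r) * f r := by
    ext t
    simp only [duhamel, Pi.sub_apply, Pi.mul_apply]
    rw [intervalIntegral.integral_symm]
    ring
  rw [h5, h4.deriv]
  simp only [Pi.sub_apply, Pi.mul_apply]
  have h6 : Real.exp (lam * t) * (Real.exp (-lam * t) * f t) = f t := by
    rw [← mul_assoc, ← Real.exp_add, neg_mul, add_neg_cancel, Real.exp_zero, one_mul]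
  rw [h6]
  ring

lemma continuousOn_duhamel (lam ψ : ℝ) (hτ : 0 < τ)
    (hf : MemLp f 2 (volume.restrict (Ioo 0 τ))) :
    ContinuousOn (duhamel lam τ ψ f) (Icc 0 τ) := by
  rw [← uIcc_of_le hτ.le]
  exact (absolutelyContinuousOnInterval_duhamel lam ψ hτ hf).continuousOn

lemma integral_Ioo_eq_intervalIntegral (hτ : 0 < τ) (g : ℝ → ℝ) :
    ∫ t in Ioo 0 τ, g t = ∫ t in (0 : ℝ)..τ, g t := by
  rw [intervalIntegral.integral_of_le hτ.le, integral_Ioc_eq_integral_Ioo]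

/-- Duhamel's formula solves the weak form of the scalar equation. -/
lemma weakDeriv_duhamel (lam ψ : ℝ) (hτ : 0 < τ)
    (hf : MemLp f 2 (volume.restrict (Ioo 0 τ))) {η : ℝ → ℝ}
    (h1 : ContDiff ℝ (⊤ : ℕ∞) η) (h3 : tsupport η ⊆ Ioo 0 τ) :
    ∫ t in Ioo 0 τ, deriv η t * duhamel lam τ ψ f t
      = - ∫ t in Ioo 0 τ, η t * (lam * duhamel lam τ ψ f t - f t) := by
  have hη : AbsolutelyContinuousOnInterval η 0 τ :=
    ContDiffOn.absolutelyContinuousOnInterval (h1.of_le (by simp)).contDiffOn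
  have hz : ∀ x, x ∉ Ioo 0 τ → η x = 0 := fun x hx =>
    image_eq_zero_of_notMem_tsupport fun h => hx (h3 h)
  have e1 := hη.integral_mul_deriv_eq_deriv_mul (absolutelyContinuousOnInterval_duhamel lam ψ hτ hf)
  rw [hz 0 (by simp), hz τ (by simp), zero_mul, zero_mul, sub_self, zero_sub,
    ← integral_Ioo_eq_intervalIntegral hτ, ← integral_Ioo_eq_intervalIntegral hτ] at e1
  rw [← neg_eq_iff_eq_neg, ← e1]
  refine setIntegral_congr_ae measurableSet_Ioo ?_
  filter_upwards [ae_deriv_duhamel lam ψ hτ hf] with t ht ht'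
  rw [ht ht']

lemma integral_mul_le_sq {g : ℝ → ℝ} (hf : MemLp f 2 (volume.restrict (Ioo 0 τ)))
    (hg : MemLp g 2 (volume.restrict (Ioo 0 τ))) :
    2 * ∫ t in Ioo 0 τ, f t * g t ≤ (∫ t in Ioo 0 τ, f t ^ 2) + ∫ t in Ioo 0 τ, g t ^ 2 := by
  rw [← integral_const_mul, ← integral_add hf.integrable_sq hg.integrable_sq]
  refine integral_mono ((hf.integrable_mul hg).const_mul 2)
    (hf.integrable_sq.add hg.integrable_sq) fun t => ?_
  change 2 * (f t * g t) ≤ f t ^ 2 + g t ^ 2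
  nlinarith [sq_nonneg (f t - g t)]

/-- Cauchy-Schwarz on `(0, τ)`. -/
lemma sq_integral_abs_le (hτ : 0 < τ) (hf : MemLp f 2 (volume.restrict (Ioo 0 τ))) :
    (∫ t in Ioo 0 τ, |f t|) ^ 2 ≤ τ * ∫ t in Ioo 0 τ, f t ^ 2 := by
  set a := ∫ t in Ioo 0 τ, |f t| with ha
  have hi : Integrable (fun t => |f t|) (volume.restrict (Ioo 0 τ)) :=
    (hf.integrable (by norm_num)).abs
  -- Expand `0 ≤ ∫ (|f| - a / τ) ^ 2`.
  have h0 : 0 ≤ ∫ t in Ioo 0 τ, (|f t| - a / τ) ^ 2 := integral_nonneg fun t => sq_nonneg _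
  have h1 : ∫ t in Ioo 0 τ, (|f t| - a / τ) ^ 2
      = (∫ t in Ioo 0 τ, f t ^ 2) - 2 * (a / τ) * a + (a / τ) ^ 2 * τ := by
    have e : ∀ t, (|f t| - a / τ) ^ 2 = f t ^ 2 - 2 * (a / τ) * |f t| + (a / τ) ^ 2 := fun t => by
      rw [sub_sq, sq_abs]
      ring
    simp_rw [e]
    have hi2 : Integrable (fun t => f t ^ 2 - 2 * (a / τ) * |f t|) (volume.restrict (Ioo 0 τ)) :=
      hf.integrable_sq.sub (hi.const_mul _)
    rw [integral_add hi2 (integrable_const _),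
      integral_sub hf.integrable_sq (hi.const_mul _), integral_const_mul, ← ha, integral_const]
    simp [measureReal_def, hτ.le, mul_comm]
  have h2 : 2 * (a / τ) * a - (a / τ) ^ 2 * τ = a ^ 2 / τ := by
    field_simp
    ring
  have h3 : a ^ 2 / τ ≤ ∫ t in Ioo 0 τ, f t ^ 2 := by linarith
  rwa [div_le_iff₀ hτ, mul_comm] at h3

/-- The uniform bound for the scalar solution. -/
lemma sq_duhamel_le (ψ : ℝ) (hlam : 0 ≤ lam) (hτ : 0 < τ)
    (hf : MemLp f 2 (volume.restrict (Ioo 0 τ))) {t : ℝ} (ht : t ∈ Icc 0 τ) :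
    duhamel lam τ ψ f t ^ 2 ≤ 2 * (ψ ^ 2 + τ * ∫ t in Ioo 0 τ, f t ^ 2) := by
  have hint := intervalIntegrable_of_memLp hτ hf
  have h1 : |Real.exp (-lam * (τ - t)) * ψ| ≤ |ψ| := by
    rw [abs_mul, abs_of_pos (Real.exp_pos _)]
    refine mul_le_of_le_one_left (abs_nonneg _) (Real.exp_le_one_iff.2 ?_)
    nlinarith [ht.2]
  have h2 : |Real.exp (lam * t) * ∫ r in t..τ, Real.exp (-lam * r) * f r|
      ≤ ∫ r in Ioo 0 τ, |f r| := by
    rw [← intervalIntegral.integral_const_mul]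
    calc |∫ r in t..τ, Real.exp (lam * t) * (Real.exp (-lam * r) * f r)|
        ≤ ∫ r in t..τ, |f r| := by
          rw [← Real.norm_eq_abs]
          refine intervalIntegral.norm_integral_le_of_norm_le ht.2 (.of_forall fun r hr => ?_) ?_
          · rw [← mul_assoc, ← Real.exp_add, Real.norm_eq_abs, abs_mul,
              abs_of_pos (Real.exp_pos _)]
            refine mul_le_of_le_one_left (abs_nonneg _) (Real.exp_le_one_iff.2 ?_)
            nlinarith [hr.1]
          · exact hint.abs.mono_set (by
              rw [uIcc_of_le ht.2, uIcc_of_le hτ.le]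
              exact Icc_subset_Icc_left ht.1)
      _ ≤ ∫ r in Ioo 0 τ, |f r| := by
          rw [intervalIntegral.integral_of_le ht.2, integral_Ioc_eq_integral_Ioo]
          exact setIntegral_mono_set ((hf.integrable (by norm_num)).abs)
            (.of_forall fun _ => abs_nonneg _) (Ioo_subset_Ioo_left ht.1).eventuallyLE
  have h3 := sq_integral_abs_le hτ hf
  have h4 : |duhamel lam τ ψ f t| ≤ |ψ| + ∫ r in Ioo 0 τ, |f r| :=
    (abs_add_le _ _).trans (add_le_add h1 h2)
  have h5 := pow_le_pow_left₀ (abs_nonneg _) h4 2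
  rw [sq_abs] at h5
  nlinarith [sq_nonneg (|ψ| - ∫ r in Ioo 0 τ, |f r|), sq_abs ψ]

lemma memLp_duhamel (lam ψ : ℝ) (hτ : 0 < τ) (hf : MemLp f 2 (volume.restrict (Ioo 0 τ))) :
    MemLp (duhamel lam τ ψ f) 2 (volume.restrict (Ioo 0 τ)) := by
  have h := continuousOn_duhamel lam ψ hτ hf
  obtain ⟨C, hC⟩ := isCompact_Icc.exists_bound_of_continuousOn h
  refine MemLp.of_bound ((h.mono Ioo_subset_Icc_self).aestronglyMeasurable measurableSet_Ioo) C ?_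
  filter_upwards [ae_restrict_mem measurableSet_Ioo] with t ht
  exact hC t (Ioo_subset_Icc_self ht)

lemma integral_sq_duhamel_le (ψ : ℝ) (hlam : 0 ≤ lam) (hτ : 0 < τ)
    (hf : MemLp f 2 (volume.restrict (Ioo 0 τ))) :
    ∫ t in Ioo 0 τ, duhamel lam τ ψ f t ^ 2
      ≤ 2 * τ * (ψ ^ 2 + τ * ∫ t in Ioo 0 τ, f t ^ 2) := by
  calc ∫ t in Ioo 0 τ, duhamel lam τ ψ f t ^ 2
      ≤ ∫ t in Ioo 0 τ, 2 * (ψ ^ 2 + τ * ∫ t in Ioo 0 τ, f t ^ 2) := by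
        refine setIntegral_mono_on (memLp_duhamel lam ψ hτ hf).integrable_sq (integrable_const _)
          measurableSet_Ioo fun t ht => sq_duhamel_le ψ hlam hτ hf (Ioo_subset_Icc_self ht)
    _ = _ := by
        rw [integral_const]
        simp [measureReal_def, hτ.le]
        ring

/-- The energy estimate for the scalar solution, from integrating the derivative of its square. -/
lemma lam_mul_integral_sq_duhamel_le (ψ : ℝ) (hlam : 0 ≤ lam) (hτ : 0 < τ)
    (hf : MemLp f 2 (volume.restrict (Ioo 0 τ))) :
    lam * ∫ t in Ioo 0 τ, duhamel lam τ ψ f t ^ 2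
      ≤ (1 + τ) * (ψ ^ 2 + (1 + τ) * ∫ t in Ioo 0 τ, f t ^ 2) := by
  have hac := absolutelyContinuousOnInterval_duhamel lam ψ hτ hf
  have hc := memLp_duhamel lam ψ hτ hf
  have e1 := hac.integral_deriv_mul_eq_sub hac
  rw [← integral_Ioo_eq_intervalIntegral hτ, duhamel_end] at e1
  have e2 : ∫ t in Ioo 0 τ, (deriv (duhamel lam τ ψ f) t * duhamel lam τ ψ f t
      + duhamel lam τ ψ f t * deriv (duhamel lam τ ψ f) t)
      = 2 * lam * (∫ t in Ioo 0 τ, duhamel lam τ ψ f t ^ 2)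
        - 2 * ∫ t in Ioo 0 τ, f t * duhamel lam τ ψ f t := by
    have hi : Integrable (fun t => f t * duhamel lam τ ψ f t) (volume.restrict (Ioo 0 τ)) :=
      hf.integrable_mul hc
    rw [← integral_const_mul, ← integral_const_mul,
      ← integral_sub (hc.integrable_sq.const_mul _) (hi.const_mul _)]
    refine setIntegral_congr_ae measurableSet_Ioo ?_
    filter_upwards [ae_deriv_duhamel lam ψ hτ hf] with t ht ht'
    rw [ht ht']
    ring
  have h1 := integral_mul_le_sq hf hc
  have h2 := integral_sq_duhamel_le ψ hlam hτ hf
  have h3 : 0 ≤ ∫ t in Ioo 0 τ, f t ^ 2 := integral_nonneg fun t => sq_nonneg _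
  have h4 : 0 ≤ τ * ∫ t in Ioo 0 τ, f t ^ 2 := by positivity
  nlinarith [mul_self_nonneg (duhamel lam τ ψ f 0), sq_nonneg ψ]

end Duhamel

/-! ### Eigenfunction expansion for a compact embedding of Hilbert spaces -/

/-- A Hilbert basis of a separable Hilbert space is countable. -/
lemma countable_of_hilbertBasis {H : Type} [NormedAddCommGroup H] [InnerProductSpace ℝ H]
    [SecondCountableTopology H] {ι : Type} (b : HilbertBasis ι ℝ H) : Countable ι := by
  have hd := TopologicalSpace.exists_countable_dense H
  obtain ⟨D, hDc, hD⟩ := hd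
  have := hDc.to_subtype
  have h : ∀ k, ∃ d : D, dist (b k) d < 1 / 2 := fun k => by
    obtain ⟨d, hd, h⟩ := hD.exists_dist_lt (b k) (by norm_num : (0 : ℝ) < 1 / 2)
    exact ⟨⟨d, hd⟩, h⟩
  choose d hd using h
  refine Function.Injective.countable (f := d) fun k l hkl => ?_
  by_contra hne
  have h1 : dist (b k) (b l) < 1 := by
    have h2 := hd l
    rw [← hkl] at h2
    linarith [dist_triangle_right (b k) (b l) (d k), hd k]
  have h3 : ‖b k - b l‖ ^ 2 = 2 := by
    rw [norm_sub_sq_real, b.orthonormal.1, b.orthonormal.1, b.orthonormal.2 hne]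
    norm_num
  rw [dist_eq_norm] at h1
  nlinarith [norm_nonneg (b k - b l)]

section Spectral

variable {H : Type} [NormedAddCommGroup H] [InnerProductSpace ℝ H] [CompleteSpace H]

open Module.End in
/-- A compact symmetric operator on a Hilbert space has a Hilbert basis of eigenvectors. -/
lemma exists_hilbertBasis_eigenvectors (T : H →L[ℝ] H) (hT : IsCompactOperator T)
    (hT' : T.IsSymmetric) :
    ∃ (ι : Type) (b : HilbertBasis ι ℝ H) (μ : ι → ℝ), ∀ k, T (b k) = μ k • b k := by
  have hcl : ∀ μ : ℝ, CompleteSpace (eigenspace (T : H →ₗ[ℝ] H) μ) := fun μ => by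
    have h : IsClosed (eigenspace (T : H →ₗ[ℝ] H) μ : Set H) := by
      have : (eigenspace (T : H →ₗ[ℝ] H) μ : Set H) = {x | T x = μ • x} := by
        ext x
        simp
      rw [this]
      exact isClosed_eq T.continuous (continuous_const_smul μ)
    exact h.completeSpace_coe
  choose w b hb using fun μ : ℝ => exists_hilbertBasis ℝ (eigenspace (T : H →ₗ[ℝ] H) μ)
  have ho := hT'.orthogonalFamily_eigenspaces.orthonormal_sigma_orthonormal
    (fun μ => (b μ).orthonormal)
  refine ⟨Σ μ : ℝ, w μ, HilbertBasis.mkOfOrthogonalEqBot ho ?_, fun k => k.1, fun k => ?_⟩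
  · rw [Submodule.eq_bot_iff]
    intro x hx
    have h1 : x ∈ (⨆ μ, eigenspace (T : H →ₗ[ℝ] H) μ)ᗮ := by
      rw [← Submodule.iInf_orthogonal, Submodule.mem_iInf]
      intro μ
      rw [Submodule.mem_orthogonal]
      intro y hy
      have h2 := (b μ).hasSum_repr ⟨y, hy⟩
      have h3 := h2.mapL ((innerSL ℝ x).comp (eigenspace (T : H →ₗ[ℝ] H) μ).subtypeL)
      have h4 : ∀ i, ((innerSL ℝ x).comp (eigenspace (T : H →ₗ[ℝ] H) μ).subtypeL)
          ((b μ).repr ⟨y, hy⟩ i • (b μ) i) = 0 := fun i => by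
        have := (Submodule.mem_orthogonal' _ _).1 hx _ (Submodule.subset_span ⟨⟨μ, i⟩, rfl⟩)
        rw [map_smul, smul_eq_zero]
        exact Or.inr this
      simp only [h4] at h3
      rw [real_inner_comm]
      exact h3.unique hasSum_zero
    rwa [ContinuousLinearMap.orthogonalComplement_iSup_eigenspaces_eq_bot hT hT',
      Submodule.mem_bot] at h1
  · rw [HilbertBasis.coe_mkOfOrthogonalEqBot]
    exact mem_eigenspace_iff.1 (b k.1 k.2).2

variable {V : Type} [NormedAddCommGroup V] [InnerProductSpace ℝ V] [CompleteSpace V]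

/-- A Hilbert basis `b` of `H` together with its lift `v` to `V` along an embedding `j : V → H`
such that `v k` represents the functional `κ k * ⟪b k, j ·⟫` in the inner product of `V`: the
variational form of an eigenvalue problem with eigenvalues `κ k`. -/
structure EigenBasis (j : V →L[ℝ] H) (ι : Type) where
  /-- The Hilbert basis of `H`. -/
  b : HilbertBasis ι ℝ H
  /-- The basis vectors as elements of `V`. -/
  v : ι → V
  /-- The eigenvalues. -/
  κ : ι → ℝ
  one_le : ∀ k, 1 ≤ κ k
  map_v : ∀ k, j (v k) = b k
  inner_v : ∀ k w, inner ℝ (v k) w = κ k * inner ℝ (b k) (j w)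

/-- The eigenvectors of the compact operator `j ∘ j†` give an eigenbasis. -/
lemma exists_eigenBasis (j : V →L[ℝ] H) (hj : IsCompactOperator j) (hn : ‖j‖ ≤ 1)
    (hd : ∀ f : H, (∀ u : V, inner ℝ f (j u) = 0) → f = 0) :
    ∃ ι : Type, Nonempty (EigenBasis j ι) := by
  set T : H →L[ℝ] H := j.comp (ContinuousLinearMap.adjoint j) with hT
  have hTi : ∀ x y, inner ℝ (T x) y
      = inner ℝ (ContinuousLinearMap.adjoint j x) (ContinuousLinearMap.adjoint j y) := fun x y => by
    rw [ContinuousLinearMap.adjoint_inner_right]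
    rfl
  obtain ⟨ι, b, μ, hb⟩ := exists_hilbertBasis_eigenvectors T (hj.comp_clm _) fun x y => by
    change inner ℝ (T x) y = inner ℝ x (T y)
    rw [hTi, real_inner_comm (T y) x, hTi, real_inner_comm]
  have hbn : ∀ k, ‖b k‖ = 1 := b.orthonormal.1
  have hμ : ∀ k, μ k = ‖ContinuousLinearMap.adjoint j (b k)‖ ^ 2 := fun k => by
    rw [← real_inner_self_eq_norm_sq, ← hTi, hb, real_inner_smul_left, real_inner_self_eq_norm_sq,
      hbn]
    ring
  have hpos : ∀ k, 0 < μ k := fun k => by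
    rw [hμ]
    refine pow_pos (norm_pos_iff.2 fun h => ?_) 2
    have h1 := hd (b k) fun u => by
      rw [← ContinuousLinearMap.adjoint_inner_left, h, inner_zero_left]
    have h2 := hbn k
    rw [h1, norm_zero] at h2
    exact zero_ne_one h2
  have hle : ∀ k, μ k ≤ 1 := fun k => by
    rw [hμ]
    refine pow_le_one₀ (norm_nonneg _) ?_
    calc _ ≤ ‖ContinuousLinearMap.adjoint j‖ * ‖b k‖ := ContinuousLinearMap.le_opNorm _ _
      _ ≤ 1 := by rw [hbn, mul_one, LinearIsometryEquiv.norm_map]; exact hn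
  refine ⟨ι, ⟨b, fun k => (μ k)⁻¹ • ContinuousLinearMap.adjoint j (b k), fun k => (μ k)⁻¹,
    fun k => (one_le_inv₀ (hpos k)).2 (hle k), fun k => ?_, fun k w => ?_⟩⟩
  · rw [map_smul]
    change (μ k)⁻¹ • T (b k) = b k
    rw [hb, smul_smul, inv_mul_cancel₀ (hpos k).ne', one_smul]
  · rw [real_inner_smul_left, ContinuousLinearMap.adjoint_inner_left]

end Spectral

/-! ### The abstract evolution equation -/

lemma hasSum_smul_hilbertBasis {H : Type} [NormedAddCommGroup H] [InnerProductSpace ℝ H]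
    {ι : Type} (b : HilbertBasis ι ℝ H) {a : ι → ℝ} (ha : Summable fun k => a k ^ 2) :
    HasSum (fun k => a k • b k) (∑' k, a k • b k) ∧
      ∀ k, inner ℝ (b k) (∑' k, a k • b k) = a k := by
  have hm : Memℓp a 2 := memℓp_gen (by simpa using ha)
  have h1 := b.hasSum_repr_symm ⟨a, hm⟩
  refine ⟨h1.summable.hasSum, fun k => ?_⟩
  have h2 : ∑' k, a k • b k = b.repr.symm ⟨a, hm⟩ := h1.tsum_eq
  rw [h2, ← b.repr_apply_apply, LinearIsometryEquiv.apply_symm_apply]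

lemma hasSum_inner_sq {H : Type} [NormedAddCommGroup H] [InnerProductSpace ℝ H]
    {ι : Type} (b : HilbertBasis ι ℝ H) (x : H) :
    HasSum (fun k => inner ℝ (b k) x ^ 2) (‖x‖ ^ 2) := by
  rw [← real_inner_self_eq_norm_sq]
  refine (b.hasSum_inner_mul_inner x x).congr_fun ?_
  intro k
  rw [real_inner_comm, sq]

lemma hilbertBasis_ext {H : Type} [NormedAddCommGroup H] [InnerProductSpace ℝ H]
    {ι : Type} (b : HilbertBasis ι ℝ H) {x y : H} (h : ∀ k, inner ℝ (b k) x = inner ℝ (b k) y) :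
    x = y := by
  rw [← sub_eq_zero, ← norm_eq_zero, ← sq_eq_zero_iff]
  refine (hasSum_inner_sq b (x - y)).unique ?_
  simp [inner_sub_right, h]

/-- Bessel's inequality for the coefficients of a function of time. -/
lemma summable_integral_inner_sq {H : Type} [NormedAddCommGroup H] [InnerProductSpace ℝ H]
    {ι : Type} (b : HilbertBasis ι ℝ H) {τ : ℝ} (F : L2Time τ H) :
    Summable (fun k => ∫ t in Ioo 0 τ, inner ℝ (b k) (F t) ^ 2) ∧
      ∑' k, ∫ t in Ioo 0 τ, inner ℝ (b k) (F t) ^ 2 ≤ ‖F‖ ^ 2 := by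
  have h1 : ∀ s : Finset ι, ∑ k ∈ s, ∫ t in Ioo 0 τ, inner ℝ (b k) (F t) ^ 2 ≤ ‖F‖ ^ 2 := by
    intro s
    have hi : ∀ k ∈ s, Integrable (fun t => inner ℝ (b k) (F t) ^ 2)
        (volume.restrict (Ioo 0 τ)) := fun k _ => ((Lp.memLp F).const_inner (b k)).integrable_sq
    rw [← integral_finsetSum _ hi, ← real_inner_self_eq_norm_sq, L2.inner_def]
    refine integral_mono (integrable_finsetSum _ hi) (L2.integrable_inner F F) fun t => ?_
    have := b.orthonormal.sum_inner_products_le (F t) (s := s)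
    simpa only [Real.norm_eq_abs, sq_abs, real_inner_self_eq_norm_sq] using this
  have h0 : ∀ k, 0 ≤ ∫ t in Ioo 0 τ, inner ℝ (b k) (F t) ^ 2 := fun k =>
    integral_nonneg fun t => sq_nonneg _
  have hs := summable_of_sum_le h0 h1
  exact ⟨hs, hs.tsum_le_of_sum_le h1⟩

/-- A continuous factor times a square integrable function of time is integrable. -/
lemma integrable_smul_of_continuous {E : Type} [NormedAddCommGroup E] [NormedSpace ℝ E] {τ : ℝ}
    {θ : ℝ → ℝ} (hθ : Continuous θ) (G : L2Time τ E) :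
    Integrable (fun t => θ t • G t) (volume.restrict (Ioo 0 τ)) := by
  have h : IntegrableOn G (Icc 0 τ) := by
    rw [integrableOn_Icc_iff_integrableOn_Ioo]
    exact (Lp.memLp G).integrable (by norm_num)
  exact (h.continuousOn_smul hθ.continuousOn isCompact_Icc).mono_set Ioo_subset_Icc_self

section Evolution

variable {V H : Type} [NormedAddCommGroup V] [InnerProductSpace ℝ V] [NormedAddCommGroup H]
  [InnerProductSpace ℝ H] {j : V →L[ℝ] H} {ι : Type}

/-- The form `c * (⟪u, w⟫_V - ⟪j u, j w⟫_H)` as an operator from `V` to its dual. -/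
def formOp (c : ℝ) (j : V →L[ℝ] H) : V →L[ℝ] StrongDual ℝ V :=
  c • (innerSL ℝ - (((ContinuousLinearMap.compL ℝ V H ℝ).flip j).comp (innerSL ℝ)).comp j)

/-- The embedding `f ↦ ⟪f, j ·⟫` of the pivot space. -/
def pivotOp (j : V →L[ℝ] H) : H →L[ℝ] StrongDual ℝ V :=
  ((ContinuousLinearMap.compL ℝ V H ℝ).flip j).comp (innerSL ℝ)

@[simp] lemma formOp_apply (c : ℝ) (j : V →L[ℝ] H) (u w : V) :
    formOp c j u w = c * (inner ℝ u w - inner ℝ (j u) (j w)) := rfl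

@[simp] lemma pivotOp_apply (j : V →L[ℝ] H) (f : H) (w : V) :
    pivotOp j f w = inner ℝ f (j w) := rfl

namespace EigenBasis

variable (E : EigenBasis j ι) (c τ : ℝ) (ψ : H) (F : L2Time τ H)

lemma norm_sq_v (k : ι) : ‖E.v k‖ ^ 2 = E.κ k := by
  rw [← real_inner_self_eq_norm_sq, E.inner_v, E.map_v, real_inner_self_eq_norm_sq,
    E.b.orthonormal.1]
  ring

lemma formOp_v (u : V) (k : ι) :
    formOp c j u (E.v k) = c * (E.κ k - 1) * inner ℝ (E.b k) (j u) := by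
  rw [formOp_apply, real_inner_comm, E.inner_v, E.map_v, real_inner_comm (E.b k)]
  ring

lemma pivotOp_v (f : H) (k : ι) : pivotOp j f (E.v k) = inner ℝ (E.b k) f := by
  rw [pivotOp_apply, E.map_v, real_inner_comm]

/-- A functional that vanishes on the eigenvectors is zero. -/
lemma eq_zero_of_apply_v [CompleteSpace V] (hj : Function.Injective j) {l : StrongDual ℝ V}
    (h : ∀ k, l (E.v k) = 0) : l = 0 := by
  set u := (InnerProductSpace.toDual ℝ V).symm l with hu
  have h1 : ∀ w, inner ℝ u w = l w := fun w => InnerProductSpace.toDual_symm_apply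
  have h2 : j u = 0 := by
    refine hilbertBasis_ext E.b fun k => ?_
    have h3 := E.inner_v k u
    rw [real_inner_comm, h1, h k] at h3
    rw [inner_zero_right]
    exact (mul_eq_zero.1 h3.symm).resolve_left (by linarith [E.one_le k])
  have h4 : u = 0 := hj (by rw [h2, map_zero])
  ext w
  rw [← h1, h4, inner_zero_left, zero_apply]

/-- The coefficient of the solution of `-y' + A y = F`, `y τ = ψ` along the `k`-th
eigenvector, where `A` is `formOp c j` and has the eigenvalue `c * (κ k - 1)` there. -/
def coef (k : ι) : ℝ → ℝ :=
  duhamel (c * (E.κ k - 1)) τ (inner ℝ (E.b k) ψ) fun t => inner ℝ (E.b k) (F t)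

/-- The solution in the pivot space. The series converges for `t` in `[0, τ]` if `0 < c`. -/
def evol (t : ℝ) : H := ∑' k, E.coef c τ ψ F k t • E.b k

/-- The common bound, up to a factor, for the squares of the coefficients. -/
def bound (k : ι) : ℝ := inner ℝ (E.b k) ψ ^ 2 + τ * ∫ t in Ioo 0 τ, inner ℝ (E.b k) (F t) ^ 2

variable {c τ} (hc : 0 < c) (hτ : 0 < τ)

lemma summable_bound : Summable (E.bound τ ψ F) :=
  (hasSum_inner_sq E.b ψ).summable.add ((summable_integral_inner_sq E.b F).1.mul_left τ)

lemma memLp_inner (k : ι) :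
    MemLp (fun t => inner ℝ (E.b k) (F t)) 2 (volume.restrict (Ioo 0 τ)) :=
  (Lp.memLp F).const_inner _

include hc in
lemma lam_nonneg (k : ι) : 0 ≤ c * (E.κ k - 1) :=
  mul_nonneg hc.le (by linarith [E.one_le k])

include hc hτ in
lemma sq_coef_le (k : ι) {t : ℝ} (ht : t ∈ Icc 0 τ) :
    E.coef c τ ψ F k t ^ 2 ≤ 2 * E.bound τ ψ F k :=
  sq_duhamel_le _ (E.lam_nonneg hc k) hτ (E.memLp_inner F k) ht

include hc hτ in
lemma summable_sq_coef {t : ℝ} (ht : t ∈ Icc 0 τ) :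
    Summable fun k => E.coef c τ ψ F k t ^ 2 :=
  Summable.of_nonneg_of_le (fun _ => sq_nonneg _) (fun k => E.sq_coef_le ψ F hc hτ k ht)
    ((E.summable_bound ψ F).mul_left 2)

include hc hτ in
lemma inner_evol (k : ι) {t : ℝ} (ht : t ∈ Icc 0 τ) :
    inner ℝ (E.b k) (E.evol c τ ψ F t) = E.coef c τ ψ F k t :=
  (hasSum_smul_hilbertBasis E.b (E.summable_sq_coef ψ F hc hτ ht)).2 k

include hc hτ in
lemma evol_end : E.evol c τ ψ F τ = ψ :=
  hilbertBasis_ext E.b fun k => by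
    rw [E.inner_evol ψ F hc hτ k (right_mem_Icc.2 hτ.le), coef, duhamel_end]

include hc hτ in
lemma norm_sq_evol_le {t : ℝ} (ht : t ∈ Icc 0 τ) :
    ‖E.evol c τ ψ F t‖ ^ 2 ≤ 2 * (‖ψ‖ ^ 2 + τ * ‖F‖ ^ 2) := by
  obtain ⟨h1, h2⟩ := summable_integral_inner_sq E.b F
  have h3 : HasSum (fun k => 2 * E.bound τ ψ F k)
      (2 * (‖ψ‖ ^ 2 + τ * ∑' k, ∫ t in Ioo 0 τ, inner ℝ (E.b k) (F t) ^ 2)) :=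
    ((hasSum_inner_sq E.b ψ).add (h1.hasSum.mul_left τ)).mul_left 2
  have h4 := hasSum_le (fun k => by
    rw [E.inner_evol ψ F hc hτ k ht]
    exact E.sq_coef_le ψ F hc hτ k ht) (hasSum_inner_sq E.b (E.evol c τ ψ F t)) h3
  have h5 := mul_le_mul_of_nonneg_left h2 hτ.le
  linarith

include hc hτ in
/-- The eigenfunction expansion converges uniformly in time, so the solution is continuous. -/
lemma continuousOn_evol : ContinuousOn (E.evol c τ ψ F) (Icc 0 τ) := by
  classical
  have hs := (E.summable_bound ψ F).mul_left 2
  have hu : TendstoUniformlyOn (fun (s : Finset ι) t => ∑ k ∈ s, E.coef c τ ψ F k t • E.b k)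
      (E.evol c τ ψ F) Filter.atTop (Icc 0 τ) := by
    rw [Metric.tendstoUniformlyOn_iff]
    intro ε hε
    have h1 := (Metric.tendsto_nhds.1 hs.hasSum) (ε ^ 2) (by positivity)
    filter_upwards [h1] with s hs' t ht
    rw [dist_eq_norm]
    refine lt_of_pow_lt_pow_left₀ 2 hε.le ?_
    have h2 := hasSum_inner_sq E.b (E.evol c τ ψ F t - ∑ k ∈ s, E.coef c τ ψ F k t • E.b k)
    have h3 : HasSum (fun k => 2 * E.bound τ ψ F k - if k ∈ s then 2 * E.bound τ ψ F k else 0)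
        ((∑' k, 2 * E.bound τ ψ F k) - ∑ k ∈ s, 2 * E.bound τ ψ F k) := by
      refine hs.hasSum.sub ?_
      have : HasSum (fun k => if k ∈ s then 2 * E.bound τ ψ F k else 0)
          (∑ k ∈ s, if k ∈ s then 2 * E.bound τ ψ F k else 0) :=
        hasSum_sum_of_ne_finset_zero fun k hk => by simp [hk]
      rwa [Finset.sum_congr rfl (fun k hk => if_pos hk)] at this
    refine (hasSum_le (fun k => ?_) h2 h3).trans_lt ?_
    · have h4 : inner ℝ (E.b k) (∑ k ∈ s, E.coef c τ ψ F k t • E.b k)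
          = if k ∈ s then E.coef c τ ψ F k t else 0 := by
        simp [inner_sum, real_inner_smul_right, orthonormal_iff_ite.1 E.b.orthonormal]
      rw [inner_sub_right, E.inner_evol ψ F hc hτ k ht, h4]
      split_ifs
      · simp
      · simpa using E.sq_coef_le ψ F hc hτ k ht
    · rw [Real.dist_eq, abs_sub_comm] at hs'
      exact (le_abs_self _).trans_lt hs'
  refine hu.continuousOn (Filter.Frequently.of_forall fun s => ?_)
  refine continuousOn_finsetSum _ fun k _ => ContinuousOn.smul ?_ continuousOn_const
  exact continuousOn_duhamel _ _ hτ (E.memLp_inner F k)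

include hc hτ in
/-- Uniqueness: the coefficients of a continuous weak solution solve the scalar equations, so the
solution is the one of the eigenfunction expansion. -/
lemma eq_evol {φ : ℝ → H} {y : ℝ → H} (hy : ContinuousOn y (Icc 0 τ))
    (hyφ : ∀ᵐ r ∂(volume.restrict (Ioo 0 τ)), y r = φ r) (hend : y τ = ψ)
    (h : ∀ k, ∀ η : ℝ → ℝ, ContDiff ℝ (⊤ : ℕ∞) η → HasCompactSupport η → tsupport η ⊆ Ioo 0 τ →
      ∫ t in Ioo 0 τ, deriv η t * inner ℝ (E.b k) (φ t)
        = - ∫ t in Ioo 0 τ, η t *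
          (c * (E.κ k - 1) * inner ℝ (E.b k) (φ t) - inner ℝ (E.b k) (F t))) :
    EqOn y (E.evol c τ ψ F) (Icc 0 τ) := by
  have key : ∀ k, EqOn (fun t => inner ℝ (E.b k) (y t) - E.coef c τ ψ F k t) 0 (Icc 0 τ) := by
    intro k
    have hy' : ContinuousOn (fun t => inner ℝ (E.b k) (y t)) (Icc 0 τ) :=
      continuousOn_const.inner hy
    have hcoef : ContinuousOn (E.coef c τ ψ F k) (Icc 0 τ) :=
      continuousOn_duhamel _ _ hτ (E.memLp_inner F k)
    refine eqOn_zero_of_weakDeriv_eq (lam := c * (E.κ k - 1)) hτ (hy'.sub hcoef) ?_ ?_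
    · rw [coef, duhamel_end, hend, sub_self]
    · intro η h1 h2 h3
      have i1 : ∀ {θ g : ℝ → ℝ}, Continuous θ → ContinuousOn g (Icc 0 τ) →
          Integrable (fun t => θ t * g t) (volume.restrict (Ioo 0 τ)) := fun hθ hg =>
        ((hθ.continuousOn.mul hg).integrableOn_compact isCompact_Icc).mono_set Ioo_subset_Icc_self
      have i2 : Integrable (fun t => η t * inner ℝ (E.b k) (F t)) (volume.restrict (Ioo 0 τ)) := by
        have := (integrable_smul_of_continuous h1.continuous F).const_inner (𝕜 := ℝ) (E.b k)
        simpa only [real_inner_smul_right] using this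
      have hd := h1.continuous_deriv (by simp)
      have e1 := weakDeriv_duhamel (c * (E.κ k - 1)) (inner ℝ (E.b k) ψ) hτ (E.memLp_inner F k)
        h1 h3
      change ∫ t in Ioo 0 τ, deriv η t * E.coef c τ ψ F k t
        = - ∫ t in Ioo 0 τ, η t * (c * (E.κ k - 1) * E.coef c τ ψ F k t
          - inner ℝ (E.b k) (F t)) at e1
      have e2 := h k η h1 h2 h3
      have e3 : ∫ t in Ioo 0 τ, deriv η t * inner ℝ (E.b k) (φ t)
          = ∫ t in Ioo 0 τ, deriv η t * inner ℝ (E.b k) (y t) :=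
        integral_congr_ae (by filter_upwards [hyφ] with t ht; rw [ht])
      have e4 : ∫ t in Ioo 0 τ, η t *
            (c * (E.κ k - 1) * inner ℝ (E.b k) (φ t) - inner ℝ (E.b k) (F t))
          = ∫ t in Ioo 0 τ, η t *
            (c * (E.κ k - 1) * inner ℝ (E.b k) (y t) - inner ℝ (E.b k) (F t)) :=
        integral_congr_ae (by filter_upwards [hyφ] with t ht; rw [ht])
      rw [e3, e4] at e2
      have i3 : ∀ {g : ℝ → ℝ}, ContinuousOn g (Icc 0 τ) → Integrable
          (fun t => η t * (c * (E.κ k - 1) * g t - inner ℝ (E.b k) (F t)))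
          (volume.restrict (Ioo 0 τ)) := fun {g} hg => by
        have := (i1 h1.continuous (g := fun t => c * (E.κ k - 1) * g t)
          (continuousOn_const.mul hg)).sub i2
        refine this.congr (.of_forall fun t => ?_)
        simp only [Pi.sub_apply]
        ring
      simp only [mul_sub]
      rw [integral_sub (i1 hd hy') (i1 hd hcoef), e1, e2, neg_sub_neg, ← neg_sub,
        ← integral_sub (i3 hy') (i3 hcoef)]
      congr 1
      exact integral_congr_ae (.of_forall fun t => by simp only; ring)
  intro t ht
  refine hilbertBasis_ext E.b fun k => ?_
  rw [E.inner_evol ψ F hc hτ k ht]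
  exact sub_eq_zero.1 (key k ht)

lemma coef_add (ψ' : H) (F' : L2Time τ H) (hτ : 0 < τ) (k : ι) {t : ℝ} (ht : t ∈ Icc 0 τ) :
    E.coef c τ (ψ + ψ') (F + F') k t = E.coef c τ ψ F k t + E.coef c τ ψ' F' k t := by
  have hsub : uIcc t τ ⊆ uIcc 0 τ := by
    rw [uIcc_of_le ht.2, uIcc_of_le hτ.le]
    exact Icc_subset_Icc_left ht.1
  have i1 := (intervalIntegrable_exp_mul (c * (E.κ k - 1)) hτ (E.memLp_inner F k)).mono_set hsub
  have i2 := (intervalIntegrable_exp_mul (c * (E.κ k - 1)) hτ (E.memLp_inner F' k)).mono_set hsub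
  simp only [coef, duhamel, inner_add_right]
  have : ∫ r in t..τ, Real.exp (-(c * (E.κ k - 1)) * r) * inner ℝ (E.b k) ((F + F') r)
      = (∫ r in t..τ, Real.exp (-(c * (E.κ k - 1)) * r) * inner ℝ (E.b k) (F r))
        + ∫ r in t..τ, Real.exp (-(c * (E.κ k - 1)) * r) * inner ℝ (E.b k) (F' r) := by
    rw [← intervalIntegral.integral_add i1 i2, intervalIntegral.integral_of_le ht.2,
      intervalIntegral.integral_of_le ht.2, integral_Ioc_eq_integral_Ioo,
      integral_Ioc_eq_integral_Ioo]
    refine integral_congr_ae ?_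
    filter_upwards [ae_restrict_of_ae_restrict_of_subset (Ioo_subset_Ioo_left ht.1)
      (Lp.coeFn_add F F')] with r hr
    rw [hr, Pi.add_apply, inner_add_right]
    ring
  rw [this]
  ring

lemma coef_smul (a : ℝ) (k : ι) {t : ℝ} (ht : t ∈ Icc 0 τ) :
    E.coef c τ (a • ψ) (a • F) k t = a * E.coef c τ ψ F k t := by
  simp only [coef, duhamel, real_inner_smul_right]
  have : ∫ r in t..τ, Real.exp (-(c * (E.κ k - 1)) * r) * inner ℝ (E.b k) ((a • F) r)
      = a * ∫ r in t..τ, Real.exp (-(c * (E.κ k - 1)) * r) * inner ℝ (E.b k) (F r) := by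
    rw [← intervalIntegral.integral_const_mul, intervalIntegral.integral_of_le ht.2,
      intervalIntegral.integral_of_le ht.2, integral_Ioc_eq_integral_Ioo,
      integral_Ioc_eq_integral_Ioo]
    refine integral_congr_ae ?_
    filter_upwards [ae_restrict_of_ae_restrict_of_subset (Ioo_subset_Ioo_left ht.1)
      (Lp.coeFn_smul a F)] with r hr
    rw [hr, Pi.smul_apply, real_inner_smul_right]
    ring
  rw [this]
  ring

include hc hτ in
lemma evol_add (ψ' : H) (F' : L2Time τ H) {t : ℝ} (ht : t ∈ Icc 0 τ) :
    E.evol c τ (ψ + ψ') (F + F') t = E.evol c τ ψ F t + E.evol c τ ψ' F' t :=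
  hilbertBasis_ext E.b fun k => by
    rw [inner_add_right, E.inner_evol _ _ hc hτ k ht, E.inner_evol _ _ hc hτ k ht,
      E.inner_evol _ _ hc hτ k ht, E.coef_add ψ F ψ' F' hτ k ht]

include hc hτ in
lemma evol_smul (a : ℝ) {t : ℝ} (ht : t ∈ Icc 0 τ) :
    E.evol c τ (a • ψ) (a • F) t = a • E.evol c τ ψ F t :=
  hilbertBasis_ext E.b fun k => by
    rw [real_inner_smul_right, E.inner_evol _ _ hc hτ k ht, E.inner_evol _ _ hc hτ k ht,
      E.coef_smul ψ F a k ht]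

end EigenBasis

end Evolution

/-! ### Existence in the energy space -/

namespace EigenBasis

variable {V H : Type} [NormedAddCommGroup V] [InnerProductSpace ℝ V] [NormedAddCommGroup H]
  [InnerProductSpace ℝ H] {j : V →L[ℝ] H} {ι : Type} (E : EigenBasis j ι) {c τ : ℝ}
  (ψ : H) (F : L2Time τ H)

lemma memLp_coef (hτ : 0 < τ) (k : ι) :
    MemLp (E.coef c τ ψ F k) 2 (volume.restrict (Ioo 0 τ)) :=
  memLp_duhamel _ _ hτ (E.memLp_inner F k)

/-- The `k`-th mode of the solution, as an element of `L²(0,τ;V)`. -/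
def mode (c : ℝ) (hτ : 0 < τ) (k : ι) : L2Time τ V :=
  (ContinuousLinearMap.toSpanSingleton ℝ (E.v k)).compLpL 2 _
    ((E.memLp_coef (c := c) ψ F hτ k).toLp _)

lemma coeFn_mode (c : ℝ) (hτ : 0 < τ) (k : ι) :
    E.mode ψ F c hτ k =ᵐ[volume.restrict (Ioo 0 τ)] fun t => E.coef c τ ψ F k t • E.v k := by
  filter_upwards [(ContinuousLinearMap.toSpanSingleton ℝ (E.v k)).coeFn_compLpL (p := 2)
    ((E.memLp_coef (c := c) ψ F hτ k).toLp _),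
    (E.memLp_coef (c := c) ψ F hτ k).coeFn_toLp] with t h1 h2
  rw [mode, h1, h2, ContinuousLinearMap.toSpanSingleton_apply]

lemma inner_mode_of_ne (c : ℝ) (hτ : 0 < τ) {k l : ι} (hkl : k ≠ l) :
    inner ℝ (E.mode ψ F c hτ k) (E.mode ψ F c hτ l) = 0 := by
  rw [L2.inner_def]
  refine integral_eq_zero_of_ae ?_
  filter_upwards [E.coeFn_mode ψ F c hτ k, E.coeFn_mode ψ F c hτ l] with t h1 h2
  rw [h1, h2, real_inner_smul_left, real_inner_smul_right, E.inner_v, E.map_v,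
    E.b.orthonormal.2 hkl]
  simp

lemma norm_sq_mode (c : ℝ) (hτ : 0 < τ) (k : ι) :
    ‖E.mode ψ F c hτ k‖ ^ 2 = E.κ k * ∫ t in Ioo 0 τ, E.coef c τ ψ F k t ^ 2 := by
  rw [← real_inner_self_eq_norm_sq, L2.inner_def, ← integral_const_mul]
  refine integral_congr_ae ?_
  filter_upwards [E.coeFn_mode ψ F c hτ k] with t h1
  rw [h1, real_inner_smul_left, real_inner_smul_right, real_inner_self_eq_norm_sq, E.norm_sq_v]
  ring

variable (hc : 0 < c) (hτ : 0 < τ)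

include hc in
/-- By the scalar energy estimate the modes are square summable in the energy space. -/
lemma summable_mode [CompleteSpace V] : Summable (E.mode ψ F c hτ) := by
  have ho : OrthogonalFamily ℝ (fun k => (ℝ ∙ E.mode ψ F c hτ k : Submodule ℝ (L2Time τ V)))
      fun k => (ℝ ∙ E.mode ψ F c hτ k : Submodule ℝ (L2Time τ V)).subtypeₗᵢ :=
    OrthogonalFamily.of_pairwise fun k l hkl => by
      change (ℝ ∙ E.mode ψ F c hτ k) ⟂ (ℝ ∙ E.mode ψ F c hτ l)
      rw [Submodule.isOrtho_span]
      rintro u hu v hv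
      rw [mem_singleton_iff.1 hu, mem_singleton_iff.1 hv]
      exact E.inner_mode_of_ne ψ F c hτ hkl
  refine (ho.summable_iff_norm_sq_summable
    fun k => ⟨E.mode ψ F c hτ k, Submodule.mem_span_singleton_self _⟩).2 ?_
  obtain ⟨h1, -⟩ := summable_integral_inner_sq E.b F
  have h2 : Summable fun k => inner ℝ (E.b k) ψ ^ 2 := (hasSum_inner_sq E.b ψ).summable
  have h3 := ((h2.add (h1.mul_left τ)).mul_left (2 * τ)).add
    (((h2.add (h1.mul_left (1 + τ))).mul_left (1 + τ)).mul_left c⁻¹)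
  refine Summable.of_nonneg_of_le (fun _ => sq_nonneg _) (fun k => ?_) h3
  change ‖E.mode ψ F c hτ k‖ ^ 2 ≤ _
  have e1 := integral_sq_duhamel_le (inner ℝ (E.b k) ψ) (E.lam_nonneg hc k) hτ (E.memLp_inner F k)
  have e2 := lam_mul_integral_sq_duhamel_le (inner ℝ (E.b k) ψ) (E.lam_nonneg hc k) hτ
    (E.memLp_inner F k)
  change ∫ t in Ioo 0 τ, E.coef c τ ψ F k t ^ 2 ≤ _ at e1
  change _ * ∫ t in Ioo 0 τ, E.coef c τ ψ F k t ^ 2 ≤ _ at e2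
  -- Since `κ = 1 + λ / c`, both estimates together bound the norm of the mode.
  rw [E.norm_sq_mode]
  have e3 := mul_le_mul_of_nonneg_left e2 (inv_pos.2 hc).le
  rw [mul_assoc, inv_mul_cancel_left₀ hc.ne'] at e3
  linarith

/-- The solution in `L²(0,τ;V)`. The series converges if `0 < c`. -/
def sol (c : ℝ) (hτ : 0 < τ) : L2Time τ V := ∑' k, E.mode ψ F c hτ k

include hc in
lemma inner_sol [CompleteSpace V] (k : ι) : ∀ᵐ t ∂(volume.restrict (Ioo 0 τ)),
    inner ℝ (E.b k) (j (E.sol ψ F c hτ t)) = E.coef c τ ψ F k t := by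
  set L : V →L[ℝ] ℝ := (innerSL ℝ (E.b k)).comp j with hL
  have h1 := (E.summable_mode ψ F hc hτ).hasSum.mapL (L.compLpL 2 (volume.restrict (Ioo 0 τ)))
  have hLm : ∀ l, L.compLpL 2 (volume.restrict (Ioo 0 τ)) (E.mode ψ F c hτ l)
      =ᵐ[volume.restrict (Ioo 0 τ)] fun t => E.coef c τ ψ F l t * inner ℝ (E.b k) (E.b l) := by
    intro l
    filter_upwards [L.coeFn_compLpL (E.mode ψ F c hτ l), E.coeFn_mode ψ F c hτ l] with t h2 h3
    rw [h2, h3, map_smul, smul_eq_mul, hL, ContinuousLinearMap.comp_apply, E.map_v,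
      innerSL_apply_apply]
  have h2 : HasSum (fun l => L.compLpL 2 (volume.restrict (Ioo 0 τ)) (E.mode ψ F c hτ l))
      (L.compLpL 2 (volume.restrict (Ioo 0 τ)) (E.mode ψ F c hτ k)) := by
    refine hasSum_single k fun l hl => ?_
    rw [Lp.eq_zero_iff_ae_eq_zero]
    filter_upwards [hLm l] with t ht
    rw [ht, E.b.orthonormal.2 hl.symm, mul_zero, Pi.zero_apply]
  have h3 := h1.unique h2
  filter_upwards [L.coeFn_compLpL (E.sol ψ F c hτ), hLm k] with t h4 h5
  rw [real_inner_self_eq_norm_sq, E.b.orthonormal.1, one_pow, mul_one] at h5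
  rw [← h5, ← h3]
  exact h4.symm

include hc in
lemma evol_eq_sol [CompleteSpace V] [Countable ι] : ∀ᵐ t ∂(volume.restrict (Ioo 0 τ)),
    E.evol c τ ψ F t = j (E.sol ψ F c hτ t) := by
  filter_upwards [ae_all_iff.2 fun k => E.inner_sol ψ F hc hτ k,
    ae_restrict_mem measurableSet_Ioo] with t h1 h2
  refine hilbertBasis_ext E.b fun k => ?_
  rw [h1 k, E.inner_evol ψ F hc hτ k (Ioo_subset_Icc_self h2)]

/-- The time derivative `A φ - F` of the solution. -/
def timeDeriv (c : ℝ) (hτ : 0 < τ) : L2Time τ (StrongDual ℝ V) :=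
  (formOp c j).compLpL 2 _ (E.sol ψ F c hτ) - (pivotOp j).compLpL 2 _ F

lemma coeFn_timeDeriv (c : ℝ) (hτ : 0 < τ) :
    E.timeDeriv ψ F c hτ =ᵐ[volume.restrict (Ioo 0 τ)]
      fun t => formOp c j (E.sol ψ F c hτ t) - pivotOp j (F t) := by
  filter_upwards [Lp.coeFn_sub ((formOp c j).compLpL 2 _ (E.sol ψ F c hτ))
    ((pivotOp j).compLpL 2 _ F), (formOp c j).coeFn_compLpL (E.sol ψ F c hτ),
    (pivotOp j).coeFn_compLpL F] with t h1 h2 h3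
  rw [timeDeriv, h1, Pi.sub_apply, h2, h3]

include hc in
/-- The weak time derivative of the solution: it suffices to test with the eigenvectors. -/
lemma integral_deriv_smul_sol [CompleteSpace V] (hj : Function.Injective j) {η : ℝ → ℝ}
    (h1 : ContDiff ℝ (⊤ : ℕ∞) η) (h3 : tsupport η ⊆ Ioo 0 τ) :
    ∫ t in Ioo 0 τ, deriv η t • pivotOp j (j (E.sol ψ F c hτ t))
      = - ∫ t in Ioo 0 τ, η t • E.timeDeriv ψ F c hτ t := by
  have i1 : Integrable (fun t => deriv η t • pivotOp j (j (E.sol ψ F c hτ t)))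
      (volume.restrict (Ioo 0 τ)) := by
    refine (integrable_smul_of_continuous (h1.continuous_deriv (by simp))
      (((pivotOp j).comp j).compLpL 2 _ (E.sol ψ F c hτ))).congr ?_
    filter_upwards [((pivotOp j).comp j).coeFn_compLpL (E.sol ψ F c hτ)] with t ht
    rw [ht, ContinuousLinearMap.comp_apply]
  have i2 := integrable_smul_of_continuous h1.continuous (E.timeDeriv ψ F c hτ)
  rw [← sub_eq_zero]
  refine E.eq_zero_of_apply_v hj fun k => ?_
  rw [sub_apply, neg_apply,
    ContinuousLinearMap.integral_apply i1, ContinuousLinearMap.integral_apply i2, sub_eq_zero]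
  have e1 := weakDeriv_duhamel (c * (E.κ k - 1)) (inner ℝ (E.b k) ψ) hτ (E.memLp_inner F k) h1 h3
  change ∫ t in Ioo 0 τ, deriv η t * E.coef c τ ψ F k t
    = - ∫ t in Ioo 0 τ, η t * (c * (E.κ k - 1) * E.coef c τ ψ F k t
      - inner ℝ (E.b k) (F t)) at e1
  refine Eq.trans ?_ (e1.trans (congrArg _ ?_))
  · refine integral_congr_ae ?_
    filter_upwards [E.inner_sol ψ F hc hτ k] with t ht
    rw [smul_apply, E.pivotOp_v, ht, smul_eq_mul]
  · refine integral_congr_ae ?_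
    filter_upwards [E.inner_sol ψ F hc hτ k, E.coeFn_timeDeriv ψ F c hτ] with t ht ht'
    rw [smul_apply, ht', sub_apply, E.pivotOp_v,
      E.formOp_v, ht, smul_eq_mul]

end EigenBasis

/-! ### The space `HsZero s`: Hilbert space structure and embedding in `L2I` -/

lemma fracConst_pos {s : ℝ} (hs0 : 0 < s) (hs1 : s < 1) : 0 < fracConst s := by
  have h1 : 0 < Real.Gamma ((2 * s + 1) / 2) := Real.Gamma_pos_of_pos (by linarith)
  have h2 : 0 < Real.Gamma (1 - s) := Real.Gamma_pos_of_pos (by linarith)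
  unfold fracConst
  positivity

namespace HsZero

variable {s : ℝ}

lemma ae_eq_zero (u : HsZero s) : ∀ᵐ x : ℝ, x ∉ Ioo (-1 : ℝ) 1 → u x = 0 :=
  (show hsZeroSubmodule s from u).2.1

lemma coeFn_toL2 (u : HsZero s) :
    (toL2 s u : ℝ → ℝ) =ᵐ[volume.restrict (Ioo (-1 : ℝ) 1)] u :=
  LpToLpRestrictCLM_coeFn ℝ (Ioo (-1 : ℝ) 1) (incl s u)

lemma incl_injective : Function.Injective (incl s) := Subtype.val_injective

lemma inner_toL2 (u v : HsZero s) : inner ℝ (toL2 s u) (toL2 s v) = ∫ x : ℝ, u x * v x := by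
  have h : ∫ x : ℝ, u x * v x = ∫ x in Ioo (-1 : ℝ) 1, u x * v x := by
    refine (setIntegral_eq_integral_of_ae_compl_eq_zero ?_).symm
    filter_upwards [u.ae_eq_zero] with x hx hx'
    rw [hx hx', zero_mul]
  rw [h, L2.inner_def]
  refine integral_congr_ae ?_
  filter_upwards [u.coeFn_toL2, v.coeFn_toL2] with x h1 h2
  rw [h1, h2]
  exact mul_comm (v x) (u x)

lemma toL2_injective : Function.Injective (toL2 s) := by
  refine (injective_iff_map_eq_zero _).2 fun u hu => ?_
  have h1 : ∀ᵐ x : ℝ, x ∈ Ioo (-1 : ℝ) 1 → u x = 0 := by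
    rw [← ae_restrict_iff' measurableSet_Ioo]
    have h2 := u.coeFn_toL2
    rw [hu] at h2
    filter_upwards [h2, Lp.coeFn_zero ℝ 2 (volume.restrict (Ioo (-1 : ℝ) 1))] with x h3 h4
    rw [← h3, h4, Pi.zero_apply]
  refine incl_injective ?_
  rw [map_zero, Lp.eq_zero_iff_ae_eq_zero]
  filter_upwards [h1, u.ae_eq_zero] with x h2 h3
  by_cases hx : x ∈ Ioo (-1 : ℝ) 1
  exacts [h2 hx, h3 hx]

lemma gagliardo_eq_inner_sub (u v : HsZero s) :
    gagliardo s u v = inner ℝ u v - inner ℝ (toL2 s u) (toL2 s v) := by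
  rw [inner_toL2, inner_def]
  ring

lemma norm_sq_eq (u : HsZero s) : ‖u‖ ^ 2 = ‖toL2 s u‖ ^ 2 + gagliardo s u u := by
  rw [← real_inner_self_eq_norm_sq, ← real_inner_self_eq_norm_sq, gagliardo_eq_inner_sub]
  ring

lemma gagliardo_self_nonneg (u : HsZero s) : 0 ≤ gagliardo s u u := by
  rw [gagliardo_eq]
  exact integral_nonneg fun p => mul_self_nonneg _

lemma norm_toL2_le_one : ‖toL2 s‖ ≤ 1 := by
  refine ContinuousLinearMap.opNorm_le_bound _ zero_le_one fun u => ?_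
  rw [one_mul]
  exact le_of_sq_le_sq (by linarith [norm_sq_eq u, gagliardo_self_nonneg u]) (norm_nonneg u)

lemma fracForm_eq_formOp (u v : HsZero s) :
    fracForm s u v = formOp (fracConst s / 2) (toL2 s) u v := by
  rw [fracForm, formOp_apply, gagliardo_eq_inner_sub]

/-- The difference quotient as a linear map to `L²(ℝ²)`. -/
def quot (s : ℝ) : HsZero s →ₗ[ℝ] Lp ℝ 2 (volume : Measure (ℝ × ℝ)) where
  toFun u := u.memLp_diffQuot.toLp _
  map_add' u v := by
    rw [← MemLp.toLp_add]
    exact MemLp.toLp_congr _ _ (diffQuot_add_ae s (incl s u) (incl s v))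
  map_smul' c u := by
    rw [RingHom.id_apply, ← MemLp.toLp_const_smul]
    exact MemLp.toLp_congr _ _ (diffQuot_smul_ae s c (incl s u))

lemma coeFn_quot (u : HsZero s) : quot s u =ᵐ[volume] diffQuot s u :=
  u.memLp_diffQuot.coeFn_toLp

lemma norm_quot_sq (u : HsZero s) : ‖quot s u‖ ^ 2 = gagliardo s u u := by
  rw [← real_inner_self_eq_norm_sq, L2.inner_def, gagliardo_eq]
  refine integral_congr_ae ?_
  filter_upwards [u.coeFn_quot] with p hp
  rw [hp]
  rfl

lemma norm_incl_eq (u : HsZero s) : ‖incl s u‖ = ‖toL2 s u‖ := by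
  rw [← sq_eq_sq₀ (norm_nonneg _) (norm_nonneg _), ← real_inner_self_eq_norm_sq,
    ← real_inner_self_eq_norm_sq, inner_toL2, L2.inner_def]
  rfl

lemma norm_sq_eq_incl_add_quot (u : HsZero s) : ‖u‖ ^ 2 = ‖incl s u‖ ^ 2 + ‖quot s u‖ ^ 2 := by
  rw [norm_sq_eq, norm_quot_sq, norm_incl_eq]

open Filter Topology in
/-- Completeness: along a subsequence a Cauchy sequence and its difference quotients converge
almost everywhere, so the limit of the difference quotients is the difference quotient of the
limit. -/
instance : CompleteSpace (HsZero s) := by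
  refine Metric.complete_of_cauchySeq_tendsto fun u hu => ?_
  have hq : ∀ v : HsZero s, ‖quot s v‖ ≤ ‖v‖ := fun v =>
    le_of_sq_le_sq (by nlinarith [norm_sq_eq_incl_add_quot v, sq_nonneg ‖incl s v‖]) (norm_nonneg v)
  have hc1 : CauchySeq fun n => incl s (u n) :=
    ((incl s).mkContinuous 1 fun v => by simpa using v.norm_incl_le).lipschitz.cauchySeq_comp hu
  have hc2 : CauchySeq fun n => quot s (u n) :=
    ((quot s).mkContinuous 1 fun v => by simpa using hq v).lipschitz.cauchySeq_comp hu
  obtain ⟨U, hU⟩ := cauchySeq_tendsto_of_complete hc1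
  obtain ⟨D, hD⟩ := cauchySeq_tendsto_of_complete hc2
  obtain ⟨φ, hφ, h1⟩ := (tendstoInMeasure_of_tendsto_Lp hU).exists_seq_tendsto_ae
  obtain ⟨χ, hχ, h2⟩ := (tendstoInMeasure_of_tendsto_Lp
    (hD.comp hφ.tendsto_atTop)).exists_seq_tendsto_ae
  have h3 : D =ᵐ[volume] diffQuot s U := by
    have h4 : ∀ᵐ p : ℝ × ℝ, ∀ n, quot s (u n) p = diffQuot s (u n) p :=
      ae_all_iff.2 fun n => (u n).coeFn_quot
    filter_upwards [h2, ae_prod_of_ae h1, h4] with p e1 e2 e3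
    refine tendsto_nhds_unique e1 ?_
    simp only [Function.comp_apply, e3]
    exact ((e2.1.comp hχ.tendsto_atTop).sub (e2.2.comp hχ.tendsto_atTop)).div_const _
  have h5 : ∀ᵐ x : ℝ, x ∉ Ioo (-1 : ℝ) 1 → U x = 0 := by
    filter_upwards [h1, ae_all_iff.2 fun n => (u n).ae_eq_zero] with x e1 e2 hx
    refine tendsto_nhds_unique e1 ?_
    simp only [e2 _ hx, tendsto_const_nhds]
  let w : HsZero s := (⟨U, h5, (memLp_congr_ae h3).1 (Lp.memLp D)⟩ : hsZeroSubmodule s)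
  have hw1 : incl s w = U := rfl
  have hw2 : quot s w = D := Lp.ext (w.coeFn_quot.trans h3.symm)
  refine ⟨w, tendsto_iff_norm_sub_tendsto_zero.2 ?_⟩
  have e1 := (tendsto_iff_norm_sub_tendsto_zero.1 hU).pow 2
  have e2 := (tendsto_iff_norm_sub_tendsto_zero.1 hD).pow 2
  have e3 := (e1.add e2).sqrt
  simp only [ne_eq, OfNat.ofNat_ne_zero, not_false_eq_true, zero_pow, add_zero,
    Real.sqrt_zero] at e3
  refine e3.congr fun n => ?_
  rw [← hw1, ← hw2, ← map_sub, ← map_sub, ← norm_sq_eq_incl_add_quot, Real.sqrt_sq (norm_nonneg _)]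

end HsZero

/-! ### Compactness of the embedding -/

open Filter Topology in
/-- An operator that is approximated in norm by its compositions with compact operators is
compact. -/
lemma isCompactOperator_of_norm_sub_le {V H : Type} [NormedAddCommGroup V] [NormedSpace ℝ V]
    [NormedAddCommGroup H] [NormedSpace ℝ H] [CompleteSpace H] (j : V →L[ℝ] H) {P : ℕ → H →L[ℝ] H}
    (hP : ∀ n, IsCompactOperator (P n)) {a : ℕ → ℝ} (ha : Tendsto a atTop (𝓝 0))
    (ha0 : ∀ n, 0 ≤ a n) (h : ∀ n u, ‖j u - P n (j u)‖ ≤ a n * ‖u‖) : IsCompactOperator j := by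
  have h1 : Tendsto (fun n => (P n).comp j) atTop (𝓝 j) := by
    rw [tendsto_iff_norm_sub_tendsto_zero]
    refine squeeze_zero (fun _ => norm_nonneg _) (fun n => ?_) ha
    rw [norm_sub_rev]
    exact ContinuousLinearMap.opNorm_le_bound _ (ha0 n) (h n)
  exact isCompactOperator_of_tendsto h1 (.of_forall fun n => (hP n).comp_clm _)

/-- The distance to the span of a finite orthonormal family. -/
lemma norm_sub_sum_inner_smul_sq {H : Type} [NormedAddCommGroup H] [InnerProductSpace ℝ H]
    {ι : Type} [Fintype ι] {e : ι → H} (he : Orthonormal ℝ e) (x : H) :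
    ‖x - ∑ i, inner ℝ (e i) x • e i‖ ^ 2 = ‖x‖ ^ 2 - ∑ i, inner ℝ (e i) x ^ 2 := by
  have h1 : inner ℝ x (∑ i, inner ℝ (e i) x • e i) = ∑ i, inner ℝ (e i) x ^ 2 := by
    simp only [inner_sum, real_inner_smul_right, real_inner_comm x, sq]
  have h2 : ‖∑ i, inner ℝ (e i) x • e i‖ ^ 2 = ∑ i, inner ℝ (e i) x ^ 2 := by
    rw [← real_inner_self_eq_norm_sq, he.inner_sum]
    simp [sq]
  rw [norm_sub_sq_real, h1, h2]
  ring

/-- The variance of `f` on `A`, as a double integral. -/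
lemma integral_prod_sub_sq {A : Set ℝ} (hA : volume A ≠ ⊤) {f : ℝ → ℝ}
    (hf : MemLp f 2 (volume.restrict A)) :
    ∫ p in A ×ˢ A, (f p.1 - f p.2) ^ 2
      = 2 * (volume.real A * ∫ x in A, f x ^ 2) - 2 * (∫ x in A, f x) ^ 2 := by
  have : IsFiniteMeasure (volume.restrict A) := ⟨by simpa using hA.lt_top⟩
  have hi : Integrable f (volume.restrict A) := hf.integrable (by norm_num)
  have i1 : Integrable (fun p : ℝ × ℝ => f p.1 ^ 2)
      ((volume.restrict A).prod (volume.restrict A)) := hf.integrable_sq.comp_fst _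
  have i2 : Integrable (fun p : ℝ × ℝ => f p.2 ^ 2)
      ((volume.restrict A).prod (volume.restrict A)) := hf.integrable_sq.comp_snd _
  have i3 : Integrable (fun p : ℝ × ℝ => f p.1 * f p.2)
      ((volume.restrict A).prod (volume.restrict A)) := hi.mul_prod hi
  have e : ∀ p : ℝ × ℝ, (f p.1 - f p.2) ^ 2 = (f p.1 ^ 2 + f p.2 ^ 2) - 2 * (f p.1 * f p.2) :=
    fun p => by ring
  have i12 : Integrable (fun p : ℝ × ℝ => f p.1 ^ 2 + f p.2 ^ 2)
      ((volume.restrict A).prod (volume.restrict A)) := i1.add i2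
  simp_rw [e]
  rw [Measure.volume_eq_prod, ← Measure.prod_restrict, integral_sub i12 (i3.const_mul 2),
    integral_add i1 i2, integral_const_mul, integral_prod_mul,
    integral_fun_fst (fun x => f x ^ 2), integral_fun_snd (fun x => f x ^ 2)]
  simp only [measureReal_restrict_apply_univ, smul_eq_mul]
  ring

/-- The `i`-th of `N` intervals of length `2 / N` that partition `(-1, 1]`. Half-open intervals
avoid overlaps; the additional point `1` is a null set. -/
def cell (N i : ℕ) : Set ℝ := Ioc (-1 + i * (2 / N : ℝ)) (-1 + (i + 1 : ℕ) * (2 / N : ℝ))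

lemma measurableSet_cell (N i : ℕ) : MeasurableSet (cell N i) := measurableSet_Ioc

lemma volume_real_cell (N i : ℕ) : volume.real (cell N i) = 2 / N := by
  rw [cell, Real.volume_real_Ioc_of_le]
  · push_cast
    ring
  · push_cast
    have : (0 : ℝ) ≤ 2 / N := by positivity
    linarith

lemma volume_cell_ne_top (N i : ℕ) : volume (cell N i) ≠ ⊤ := measure_Ioc_lt_top.ne

lemma abs_sub_le_of_mem_cell {N i : ℕ} {x y : ℝ} (hx : x ∈ cell N i) (hy : y ∈ cell N i) :
    |x - y| ≤ 2 / N := by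
  obtain ⟨h1, h2⟩ := hx
  obtain ⟨h3, h4⟩ := hy
  push_cast at h2 h4
  rw [abs_le]
  constructor <;> nlinarith

lemma pairwise_disjoint_cell (N : ℕ) : Pairwise (Function.onFun Disjoint (cell N)) := by
  have h0 : (0 : ℝ) ≤ 2 / N := by positivity
  have : Monotone fun i : ℕ => -1 + (i : ℝ) * (2 / N : ℝ) := fun i j hij => by
    have : (i : ℝ) ≤ j := by exact_mod_cast hij
    simp only
    nlinarith
  exact this.pairwise_disjoint_on_Ioc_succ

lemma cell_subset {N i : ℕ} (hi : i < N) : cell N i ⊆ Ioc (-1) 1 := by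
  have hN : (0 : ℝ) < N := by exact_mod_cast (Nat.zero_le i).trans_lt hi
  have h0 : (0 : ℝ) ≤ 2 / N := by positivity
  refine Ioc_subset_Ioc (by simpa using by positivity) ?_
  have h1 : ((i + 1 : ℕ) : ℝ) ≤ N := by exact_mod_cast hi
  have h2 : (N : ℝ) * (2 / N) = 2 := by field_simp
  nlinarith

lemma sum_integral_cell {N : ℕ} (hN : 0 < N) {g : ℝ → ℝ}
    (hg : IntegrableOn g (Ioc (-1) 1)) :
    ∑ i : Fin N, ∫ x in cell N i, g x = ∫ x in Ioc (-1 : ℝ) 1, g x := by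
  have hN' : (0 : ℝ) < N := by exact_mod_cast hN
  have h0 : (0 : ℝ) ≤ 2 / N := by positivity
  have hle : ∀ i : ℕ, -1 + (i : ℝ) * (2 / N : ℝ) ≤ -1 + (i + 1 : ℕ) * (2 / N : ℝ) := fun i => by
    push_cast
    linarith
  have h2 : (N : ℝ) * (2 / N) = 2 := by field_simp
  have h := intervalIntegral.sum_integral_adjacent_intervals (μ := volume) (f := g)
    (a := fun i : ℕ => -1 + (i : ℝ) * (2 / N : ℝ)) (n := N) fun i hi => by
      rw [intervalIntegrable_iff_integrableOn_Ioc_of_le (hle i)]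
      exact hg.mono_set (cell_subset hi)
  rw [Nat.cast_zero, zero_mul, add_zero, h2, show (-1 : ℝ) + 2 = 1 by norm_num,
    intervalIntegral.integral_of_le (by norm_num)] at h
  rw [← h, Finset.sum_range]
  refine Finset.sum_congr rfl fun i _ => ?_
  rw [intervalIntegral.integral_of_le (hle i)]
  rfl

lemma restrict_restrict_cell {N i : ℕ} (hi : i < N) :
    (volume.restrict (Ioo (-1 : ℝ) 1)).restrict (cell N i) = volume.restrict (cell N i) := by
  rw [restrict_Ioo_eq_restrict_Ioc, Measure.restrict_restrict (measurableSet_cell N i),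
    inter_eq_self_of_subset_left (cell_subset hi)]

/-- The indicator function of a cell, normalized in `L²(-1,1)`. -/
def cellVec (N : ℕ) (i : Fin N) : L2I :=
  (√(2 / N))⁻¹ • indicatorConstLp 2 (measurableSet_cell N i) (measure_ne_top _ _) (1 : ℝ)

lemma inner_cellVec {N : ℕ} (i : Fin N) (f : L2I) :
    inner ℝ (cellVec N i) f = (√(2 / N))⁻¹ * ∫ x in cell N i, f x := by
  rw [cellVec, real_inner_smul_left, L2.inner_indicatorConstLp_one, restrict_restrict_cell i.2]

lemma orthonormal_cellVec {N : ℕ} (hN : 0 < N) : Orthonormal ℝ (cellVec N) := by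
  have hN' : (0 : ℝ) < 2 / N := by positivity
  classical
  rw [orthonormal_iff_ite]
  intro i k
  rw [cellVec, cellVec, real_inner_smul_left, real_inner_smul_right,
    L2.real_inner_indicatorConstLp_one_indicatorConstLp_one]
  split_ifs with h
  · rw [h, inter_self, ← measureReal_restrict_apply_univ, restrict_restrict_cell k.2,
      measureReal_restrict_apply_univ, volume_real_cell, ← mul_assoc, ← mul_inv,
      Real.mul_self_sqrt hN'.le, inv_mul_cancel₀ hN'.ne']
  · have h1 : cell N i ∩ cell N k = ∅ :=
      disjoint_iff_inter_eq_empty.1 (pairwise_disjoint_cell N fun e => h (Fin.ext e))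
    rw [h1, measureReal_empty, mul_zero, mul_zero]

/-- The orthogonal projection onto the functions that are constant on each cell. -/
def cellProj (N : ℕ) : L2I →L[ℝ] L2I :=
  ∑ i : Fin N, (ContinuousLinearMap.toSpanSingleton ℝ (cellVec N i)).comp
    (innerSL ℝ (cellVec N i))

lemma cellProj_apply (N : ℕ) (f : L2I) :
    cellProj N f = ∑ i, inner ℝ (cellVec N i) f • cellVec N i := by
  simp [cellProj]

lemma isCompactOperator_cellProj (N : ℕ) : IsCompactOperator (cellProj N) := by
  have h : cellProj N ∈ compactOperator (RingHom.id ℝ) L2I L2I :=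
    Submodule.sum_mem _ fun i _ =>
      (isCompactOperator_of_locallyCompactSpace_rng
        (ContinuousLinearMap.toSpanSingleton ℝ (cellVec N i))).comp_clm _
  exact h

/-- On the diagonal, where the difference quotient is `0 / 0`, both sides vanish. -/
lemma sub_sq_le_mul_diffQuot_sq {s δ : ℝ} (hs : 0 < s) (u : ℝ → ℝ) {p : ℝ × ℝ}
    (hp : |p.1 - p.2| ≤ δ) :
    (u p.1 - u p.2) ^ 2 ≤ δ ^ (1 + 2 * s) * (diffQuot s u p * diffQuot s u p) := by
  rw [diffQuot_mul, ← sq]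
  rcases eq_or_ne p.1 p.2 with h | h
  · simp [h]
  · have h1 : 0 < |p.1 - p.2| := abs_pos.2 (sub_ne_zero.2 h)
    have h2 : 0 < |p.1 - p.2| ^ (1 + 2 * s) := Real.rpow_pos_of_pos h1 _
    have h3 : |p.1 - p.2| ^ (1 + 2 * s) ≤ δ ^ (1 + 2 * s) :=
      Real.rpow_le_rpow h1.le hp (by linarith)
    calc (u p.1 - u p.2) ^ 2
        = |p.1 - p.2| ^ (1 + 2 * s) * ((u p.1 - u p.2) ^ 2 / |p.1 - p.2| ^ (1 + 2 * s)) := by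
          field_simp
      _ ≤ _ := mul_le_mul_of_nonneg_right h3 (by positivity)

namespace HsZero

variable {s : ℝ}

/-- A Poincaré inequality on each cell bounds the distance to the piecewise constant functions. -/
lemma norm_sub_cellProj_sq_le (hs : 0 < s) {N : ℕ} (hN : 0 < N) (u : HsZero s) :
    ‖toL2 s u - cellProj N (toL2 s u)‖ ^ 2 ≤ ((2 / N : ℝ) ^ s * ‖u‖) ^ 2 := by
  have hN' : (0 : ℝ) < 2 / N := by positivity
  have hu : MemLp u 2 (volume : Measure ℝ) := u.memLp
  have hd : Integrable (fun p => diffQuot s u p * diffQuot s u p) :=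
    u.memLp_diffQuot.integrable_mul u.memLp_diffQuot
  have hae : ∀ i : Fin N, (toL2 s u : ℝ → ℝ) =ᵐ[volume.restrict (cell N i)] u := fun i => by
    rw [← restrict_restrict_cell i.2]
    exact ae_restrict_of_ae u.coeFn_toL2
  rw [cellProj_apply, norm_sub_sum_inner_smul_sq (orthonormal_cellVec hN)]
  have e1 : ‖toL2 s u‖ ^ 2 = ∑ i : Fin N, ∫ x in cell N i, u x ^ 2 := by
    rw [sum_integral_cell hN hu.integrable_sq.integrableOn, ← real_inner_self_eq_norm_sq,
      L2.inner_def, ← restrict_Ioo_eq_restrict_Ioc]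
    refine integral_congr_ae ?_
    filter_upwards [u.coeFn_toL2] with x hx
    rw [hx]
    exact (sq _).symm
  have e2 : ∀ i : Fin N, inner ℝ (cellVec N i) (toL2 s u) ^ 2
      = (2 / N : ℝ)⁻¹ * (∫ x in cell N i, u x) ^ 2 := fun i => by
    rw [inner_cellVec, integral_congr_ae (hae i), mul_pow, inv_pow, Real.sq_sqrt hN'.le]
  have e3 : ∀ i : Fin N, (∫ x in cell N i, u x ^ 2) - (2 / N : ℝ)⁻¹ * (∫ x in cell N i, u x) ^ 2
      ≤ (2 / N : ℝ) ^ (2 * s) * ∫ p in cell N i ×ˢ cell N i, diffQuot s u p * diffQuot s u p := by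
    intro i
    have h1 := integral_prod_sub_sq (volume_cell_ne_top N i) (hu.restrict _)
    rw [volume_real_cell] at h1
    have h2 : ∫ p in cell N i ×ˢ cell N i, (u p.1 - u p.2) ^ 2
        ≤ (2 / N : ℝ) ^ (1 + 2 * s)
          * ∫ p in cell N i ×ˢ cell N i, diffQuot s u p * diffQuot s u p := by
      rw [← integral_const_mul]
      refine integral_mono_of_nonneg (.of_forall fun p => sq_nonneg _)
        (hd.integrableOn.const_mul _) ?_
      filter_upwards [ae_restrict_mem ((measurableSet_cell N i).prod (measurableSet_cell N i))]
        with p hp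
      exact sub_sq_le_mul_diffQuot_sq hs u (abs_sub_le_of_mem_cell hp.1 hp.2)
    rw [h1, Real.rpow_add hN', Real.rpow_one, mul_assoc] at h2
    have h3 : 0 ≤ (2 / N : ℝ) ^ (2 * s)
        * ∫ p in cell N i ×ˢ cell N i, diffQuot s u p * diffQuot s u p :=
      mul_nonneg (Real.rpow_nonneg hN'.le _) (integral_nonneg fun p => mul_self_nonneg _)
    refine le_of_mul_le_mul_left ?_ hN'
    rw [mul_sub, mul_inv_cancel_left₀ hN'.ne']
    nlinarith [mul_nonneg hN'.le h3]
  calc ‖toL2 s u‖ ^ 2 - ∑ i, inner ℝ (cellVec N i) (toL2 s u) ^ 2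
      = ∑ i : Fin N, ((∫ x in cell N i, u x ^ 2)
          - (2 / N : ℝ)⁻¹ * (∫ x in cell N i, u x) ^ 2) := by
        rw [e1, Finset.sum_sub_distrib, Finset.sum_congr rfl fun i _ => e2 i]
    _ ≤ ∑ i : Fin N, (2 / N : ℝ) ^ (2 * s)
          * ∫ p in cell N i ×ˢ cell N i, diffQuot s u p * diffQuot s u p :=
        Finset.sum_le_sum fun i _ => e3 i
    _ = (2 / N : ℝ) ^ (2 * s) * ∫ p in ⋃ i ∈ (Finset.univ : Finset (Fin N)),
          cell N i ×ˢ cell N i, diffQuot s u p * diffQuot s u p := by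
        rw [← Finset.mul_sum, integral_biUnion_finset]
        · exact fun i _ => (measurableSet_cell N i).prod (measurableSet_cell N i)
        · exact fun i _ k _ hik => Disjoint.set_prod_left
            (pairwise_disjoint_cell N fun e => hik (Fin.ext e)) _ _
        · exact fun i _ => hd.integrableOn
    _ ≤ (2 / N : ℝ) ^ (2 * s) * gagliardo s u u := by
        rw [gagliardo_eq]
        exact mul_le_mul_of_nonneg_left
          (setIntegral_le_integral hd (.of_forall fun p => mul_self_nonneg _))
          (Real.rpow_nonneg hN'.le _)
    _ ≤ ((2 / N : ℝ) ^ s * ‖u‖) ^ 2 := by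
        rw [mul_pow, ← Real.rpow_natCast ((2 / N : ℝ) ^ s), ← Real.rpow_mul hN'.le, mul_comm s,
          Nat.cast_ofNat]
        refine mul_le_mul_of_nonneg_left ?_ (Real.rpow_nonneg hN'.le _)
        linarith [norm_sq_eq u, sq_nonneg ‖toL2 s u‖]

/-- The embedding is the norm limit of its compositions with the projections `cellProj N`. -/
lemma isCompactOperator_toL2 (hs : 0 < s) : IsCompactOperator (toL2 s) := by
  refine isCompactOperator_of_norm_sub_le (toL2 s)
    (fun N => isCompactOperator_cellProj (N + 1)) (a := fun N => (2 / ((N + 1 : ℕ) : ℝ)) ^ s) ?_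
    (fun N => by positivity) fun N u =>
      le_of_sq_le_sq (norm_sub_cellProj_sq_le hs N.succ_pos u) (by positivity)
  have h2 : Filter.Tendsto (fun N : ℕ => 2 / ((N + 1 : ℕ) : ℝ)) Filter.atTop (nhds 0) :=
    (tendsto_const_div_atTop_nhds_zero_nat 2).comp (Filter.tendsto_add_atTop_nat 1)
  have h3 := h2.rpow_const (p := s) (Or.inr hs.le)
  rwa [Real.zero_rpow hs.ne'] at h3

end HsZero

/-! ### Density of the embedding -/

/-- The squared difference quotient of a bounded Lipschitz function is at most a constant times
this function of `|x - y|`, which is integrable for `0 < s < 1`. -/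
def kernelBound (s r : ℝ) : ℝ := if r ≤ 1 then r ^ (1 - 2 * s) else r ^ (-1 - 2 * s)

lemma kernelBound_nonneg (s : ℝ) {r : ℝ} (hr : 0 ≤ r) : 0 ≤ kernelBound s r := by
  unfold kernelBound
  split_ifs <;> positivity

lemma integrable_kernelBound {s : ℝ} (hs0 : 0 < s) (hs1 : s < 1) :
    Integrable fun x : ℝ => kernelBound s |x| := by
  simp_rw [← Real.norm_eq_abs]
  rw [integrable_fun_norm_addHaar]
  simp only [Module.finrank_self, tsub_self, pow_zero, one_smul]
  rw [← Ioc_union_Ioi_eq_Ioi (zero_le_one' ℝ)]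
  refine IntegrableOn.union ?_ ?_
  · have h : IntegrableOn (fun r : ℝ => r ^ (1 - 2 * s)) (Ioc 0 1) := by
      rw [← intervalIntegrable_iff_integrableOn_Ioc_of_le zero_le_one]
      exact intervalIntegral.intervalIntegrable_rpow' (by linarith)
    refine h.congr_fun (fun r hr => ?_) measurableSet_Ioc
    rw [kernelBound, if_pos hr.2]
  · have h : IntegrableOn (fun r : ℝ => r ^ (-1 - 2 * s)) (Ioi 1) :=
      integrableOn_Ioi_rpow_of_lt (by linarith) one_pos
    refine h.congr_fun (fun r hr => ?_) measurableSet_Ioi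
    rw [kernelBound, if_neg (not_le.2 hr)]

lemma diffQuot_sq_le {s : ℝ} {η : ℝ → ℝ} {K M : ℝ}
    (hK : ∀ x y, |η x - η y| ≤ K * |x - y|) (hM : ∀ x, |η x| ≤ M) (p : ℝ × ℝ) :
    diffQuot s η p ^ 2 ≤ (K ^ 2 + 4 * M ^ 2) * kernelBound s |p.1 - p.2| := by
  have hpos := abs_nonneg (p.1 - p.2)
  rw [sq, diffQuot_mul, ← sq]
  rcases hpos.eq_or_lt with h | h
  · have h1 : p.1 = p.2 := sub_eq_zero.1 (abs_eq_zero.1 h.symm)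
    rw [h1, sub_self, zero_pow two_ne_zero, zero_div]
    exact mul_nonneg (by positivity) (kernelBound_nonneg s (abs_nonneg _))
  · rw [div_le_iff₀ (Real.rpow_pos_of_pos h _), mul_assoc, kernelBound]
    split_ifs with h1
    · have e : |p.1 - p.2| ^ (1 - 2 * s) * |p.1 - p.2| ^ (1 + 2 * s) = |p.1 - p.2| ^ 2 := by
        rw [← Real.rpow_add h, ← Real.rpow_natCast]
        congr 1
        push_cast
        ring
      rw [e]
      have h2 := pow_le_pow_left₀ (abs_nonneg _) (hK p.1 p.2) 2
      rw [sq_abs, mul_pow] at h2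
      nlinarith [mul_nonneg (sq_nonneg M) (sq_nonneg |p.1 - p.2|)]
    · have e : |p.1 - p.2| ^ (-1 - 2 * s) * |p.1 - p.2| ^ (1 + 2 * s) = 1 := by
        rw [← Real.rpow_add h]
        ring_nf
        exact Real.rpow_zero _
      rw [e]
      have h2 : |η p.1 - η p.2| ≤ 2 * M := (abs_sub _ _).trans (by linarith [hM p.1, hM p.2])
      have h3 := pow_le_pow_left₀ (abs_nonneg _) h2 2
      rw [sq_abs] at h3
      nlinarith [sq_nonneg K]

/-- Smooth functions with compact support in `(-1, 1)` have a finite Gagliardo integral. -/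
lemma memLp_diffQuot_of_contDiff {s : ℝ} (hs0 : 0 < s) (hs1 : s < 1) {η : ℝ → ℝ}
    (h1 : ContDiff ℝ (⊤ : ℕ∞) η) (h2 : HasCompactSupport η)
    (h3 : tsupport η ⊆ Ioo (-1 : ℝ) 1) :
    MemLp (diffQuot s η) 2 (volume : Measure (ℝ × ℝ)) := by
  obtain ⟨K, hK⟩ := (h1.of_le (by simp) : ContDiff ℝ 1 η).lipschitzWith_of_hasCompactSupport h2
    (by simp)
  obtain ⟨M, hM⟩ := h2.exists_bound_of_continuous h1.continuous
  have hmeas : Measurable (diffQuot s η) := by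
    have := h1.continuous.measurable
    unfold diffQuot
    fun_prop
  rw [memLp_two_iff_integrable_sq hmeas.aestronglyMeasurable]
  set k : ℝ → ℝ := fun x => kernelBound s |x| with hk
  have hki : Integrable k := integrable_kernelBound hs0 hs1
  have hind : Integrable ((Ioo (-1 : ℝ) 1).indicator (1 : ℝ → ℝ)) :=
    (integrable_indicator_iff measurableSet_Ioo).2 (integrableOn_const (by simp))
  have i1 : Integrable (fun p : ℝ × ℝ => (Ioo (-1 : ℝ) 1).indicator (1 : ℝ → ℝ) p.2 * k (p.1 - p.2))
      (volume : Measure (ℝ × ℝ)) := hind.convolution_integrand (.mul ℝ ℝ) hki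
  have i2 : Integrable (fun p : ℝ × ℝ => (Ioo (-1 : ℝ) 1).indicator (1 : ℝ → ℝ) p.1 * k (p.2 - p.1))
      (volume : Measure (ℝ × ℝ)) := i1.swap
  refine ((i2.add i1).const_mul ((K : ℝ) ^ 2 + 4 * M ^ 2)).mono'
    (hmeas.pow_const 2).aestronglyMeasurable (.of_forall fun p => ?_)
  have hb := diffQuot_sq_le (s := s) (η := η) (K := K) (M := M)
    (fun x y => by simpa [Real.dist_eq] using hK.dist_le_mul x y) hM p
  have hk0 : ∀ x, 0 ≤ k x := fun x => kernelBound_nonneg s (abs_nonneg x)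
  have hsymm : k (p.2 - p.1) = k (p.1 - p.2) := by rw [hk]; simp only [abs_sub_comm]
  have hz : ∀ x, x ∉ Ioo (-1 : ℝ) 1 → η x = 0 := fun x hx =>
    image_eq_zero_of_notMem_tsupport fun h => hx (h3 h)
  have hC : 0 ≤ ((K : ℝ) ^ 2 + 4 * M ^ 2) := by positivity
  have hb' : diffQuot s η p ^ 2 ≤ ((K : ℝ) ^ 2 + 4 * M ^ 2) * k (p.1 - p.2) := hb
  have hCk := mul_nonneg hC (hk0 (p.1 - p.2))
  rw [Real.norm_eq_abs, abs_of_nonneg (sq_nonneg _)]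
  simp only [Pi.add_apply, hsymm]
  by_cases hp1 : p.1 ∈ Ioo (-1 : ℝ) 1
  · by_cases hp2 : p.2 ∈ Ioo (-1 : ℝ) 1
    · rw [indicator_of_mem hp1, indicator_of_mem hp2]
      simp only [Pi.one_apply, one_mul]
      linarith
    · rw [indicator_of_mem hp1, indicator_of_notMem hp2]
      simp only [Pi.one_apply, one_mul, zero_mul, add_zero]
      exact hb'
  · by_cases hp2 : p.2 ∈ Ioo (-1 : ℝ) 1
    · rw [indicator_of_notMem hp1, indicator_of_mem hp2]
      simp only [Pi.one_apply, one_mul, zero_mul, zero_add]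
      exact hb'
    · rw [indicator_of_notMem hp1, indicator_of_notMem hp2, diffQuot, hz _ hp1, hz _ hp2]
      simp

/-- The range of the embedding is dense, as it contains the test functions. -/
lemma HsZero.eq_zero_of_inner_toL2_eq_zero {s : ℝ} (hs0 : 0 < s) (hs1 : s < 1) {f : L2I}
    (h : ∀ u : HsZero s, inner ℝ f (HsZero.toL2 s u) = 0) : f = 0 := by
  have hf : LocallyIntegrableOn f (Ioo (-1 : ℝ) 1) :=
    IntegrableOn.locallyIntegrableOn ((Lp.memLp f).integrable (by norm_num))
  have key := isOpen_Ioo.ae_eq_zero_of_integral_contDiff_smul_eq_zero hf fun η h1 h2 h3 => by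
    have hη : MemLp η 2 (volume : Measure ℝ) := h1.continuous.memLp_of_hasCompactSupport h2
    have hz : ∀ x, x ∉ Ioo (-1 : ℝ) 1 → η x = 0 := fun x hx =>
      image_eq_zero_of_notMem_tsupport fun h => hx (h3 h)
    have hq : diffQuot s (hη.toLp η) =ᵐ[volume] diffQuot s η := by
      filter_upwards [ae_prod_of_ae hη.coeFn_toLp] with p hp
      rw [diffQuot, diffQuot, hp.1, hp.2]
    let u : HsZero s := (⟨hη.toLp η, by
      refine ⟨?_, (memLp_congr_ae hq).2 (memLp_diffQuot_of_contDiff hs0 hs1 h1 h2 h3)⟩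
      filter_upwards [hη.coeFn_toLp] with x hx hx'
      rw [hx, hz x hx']⟩ : hsZeroSubmodule s)
    have e := h u
    rw [L2.inner_def] at e
    rw [← setIntegral_eq_integral_of_forall_compl_eq_zero (s := Ioo (-1 : ℝ) 1)
      fun x hx => by rw [hz x hx, zero_smul]]
    rw [← e]
    refine integral_congr_ae ?_
    have hu : (u : ℝ → ℝ) =ᵐ[volume] η := hη.coeFn_toLp
    filter_upwards [u.coeFn_toL2, ae_restrict_of_ae hu] with x e1 e2
    rw [e1, e2]
    rfl
  rw [Lp.eq_zero_iff_ae_eq_zero, Filter.EventuallyEq, ae_restrict_iff' measurableSet_Ioo]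
  exact key

/-- The fractional Laplacian on `(-1, 1)` has an eigenbasis. -/
lemma HsZero.exists_eigenBasis {s : ℝ} (hs0 : 0 < s) (hs1 : s < 1) :
    ∃ ι : Type, Nonempty (EigenBasis (HsZero.toL2 s) ι) :=
  FracHUM.exists_eigenBasis _ (HsZero.isCompactOperator_toL2 hs0) HsZero.norm_toL2_le_one
    fun _ h => HsZero.eq_zero_of_inner_toL2_eq_zero hs0 hs1 h

/-! ### Well-posedness of the controlled equation -/

lemma memLp_restrict_of_subset {ω : Set ℝ} (hωI : ω ⊆ Ioo (-1 : ℝ) 1) (f : L2I) :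
    MemLp f 2 (volume.restrict ω) :=
  (Lp.memLp f).mono_measure (Measure.restrict_mono_set volume hωI)

/-- The restriction of functions from `(-1,1)` to `ω`. -/
def restrictL {ω : Set ℝ} (hωI : ω ⊆ Ioo (-1 : ℝ) 1) :
    L2I →L[ℝ] Lp ℝ 2 (volume.restrict ω) :=
  LinearMap.mkContinuous
    { toFun := fun f => (memLp_restrict_of_subset hωI f).toLp f
      map_add' := fun f g => by
        rw [← MemLp.toLp_add]
        exact MemLp.toLp_congr _ _
          (ae_restrict_of_ae_restrict_of_subset hωI (Lp.coeFn_add f g))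
      map_smul' := fun a f => by
        rw [RingHom.id_apply, ← MemLp.toLp_const_smul]
        exact MemLp.toLp_congr _ _
          (ae_restrict_of_ae_restrict_of_subset hωI (Lp.coeFn_smul a f)) }
    1 fun f => by
      rw [one_mul]
      change ‖(memLp_restrict_of_subset hωI f).toLp f‖ ≤ ‖f‖
      rw [Lp.norm_toLp, Lp.norm_def]
      exact ENNReal.toReal_mono (Lp.eLpNorm_ne_top f)
        (eLpNorm_mono_measure _ (Measure.restrict_mono_set volume hωI))

lemma coeFn_restrictL {ω : Set ℝ} (hωI : ω ⊆ Ioo (-1 : ℝ) 1) (f : L2I) :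
    restrictL hωI f =ᵐ[volume.restrict ω] f :=
  (memLp_restrict_of_subset hωI f).coeFn_toLp

/-- The right-hand side `h χ_ω` of the equation. The extension of functions on `ω` by zero is the
adjoint of the restriction. -/
def source {ω : Set ℝ} (hωI : ω ⊆ Ioo (-1 : ℝ) 1) (τ : ℝ) : Control τ ω →L[ℝ] L2Time τ L2I :=
  (ContinuousLinearMap.adjoint (restrictL hωI)).compLpL 2 _

lemma inner_source {s τ : ℝ} {ω : Set ℝ} (hωI : ω ⊆ Ioo (-1 : ℝ) 1) (h : Control τ ω) :
    ∀ᵐ t ∂(volume.restrict (Ioo 0 τ)), ∀ w : HsZero s,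
      inner ℝ (source hωI τ h t) (HsZero.toL2 s w) = ∫ x in ω, h t x * w x := by
  filter_upwards [(ContinuousLinearMap.adjoint (restrictL hωI)).coeFn_compLpL (p := 2) h] with t ht w
  rw [source, ht, ContinuousLinearMap.adjoint_inner_left, L2.inner_def]
  refine integral_congr_ae ?_
  filter_upwards [coeFn_restrictL hωI (HsZero.toL2 s w),
    ae_restrict_of_ae_restrict_of_subset hωI w.coeFn_toL2] with x h1 h2
  rw [h1, h2]
  exact mul_comm _ _

lemma pivot_eq_pivotOp (s : ℝ) (f : L2I) : pivot s f = pivotOp (HsZero.toL2 s) f := rfl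

section WellPosed

variable {s τ : ℝ} {ω : Set ℝ} {ι : Type} (E : EigenBasis (HsZero.toL2 s) ι)
  (hωI : ω ⊆ Ioo (-1 : ℝ) 1) {ψ : L2I} {h : Control τ ω} {φ : L2Time τ (HsZero s)}

/-- Testing with `η t • v k` reduces the equation to its scalar components. -/
lemma weak_coef_of_isState (hφ : IsState s τ ω ψ h φ) (k : ι) {η : ℝ → ℝ}
    (h1 : ContDiff ℝ (⊤ : ℕ∞) η) (h2 : HasCompactSupport η) (h3 : tsupport η ⊆ Ioo 0 τ) :
    ∫ t in Ioo 0 τ, deriv η t * inner ℝ (E.b k) (HsZero.toL2 s (φ t))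
      = - ∫ t in Ioo 0 τ, η t * (fracConst s / 2 * (E.κ k - 1)
          * inner ℝ (E.b k) (HsZero.toL2 s (φ t)) - inner ℝ (E.b k) (source hωI τ h t)) := by
  obtain ⟨⟨g, hg, hw⟩, -⟩ := hφ
  have i1 : Integrable (fun t => deriv η t • pivotOp (HsZero.toL2 s) (HsZero.toL2 s (φ t)))
      (volume.restrict (Ioo 0 τ)) := by
    refine (integrable_smul_of_continuous (h1.continuous_deriv (by simp))
      (((pivotOp (HsZero.toL2 s)).comp (HsZero.toL2 s)).compLpL 2 _ φ)).congr ?_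
    filter_upwards [((pivotOp (HsZero.toL2 s)).comp (HsZero.toL2 s)).coeFn_compLpL φ] with t ht
    rw [ht, ContinuousLinearMap.comp_apply]
  have i2 := integrable_smul_of_continuous h1.continuous g
  have e1 := congrArg (fun l : HsDual s => l (E.v k)) (hg η h1 h2 h3)
  simp only [pivot_eq_pivotOp] at e1
  rw [neg_apply, ContinuousLinearMap.integral_apply i1, ContinuousLinearMap.integral_apply i2] at e1
  simp only [smul_apply, E.pivotOp_v, smul_eq_mul] at e1
  have hm : MemLp (fun t => η t • E.v k) 2 (volume.restrict (Ioo 0 τ)) :=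
    ((h1.continuous.smul continuous_const).memLp_of_hasCompactSupport h2.smul_right).restrict _
  have e2 := hw (hm.toLp _)
  have e3 : ∫ t in Ioo 0 τ, (g t) (hm.toLp _ t) = ∫ t in Ioo 0 τ, η t * (g t) (E.v k) := by
    refine integral_congr_ae ?_
    filter_upwards [hm.coeFn_toLp] with t ht
    rw [ht, map_smul, smul_eq_mul]
  have e4 : ∫ t in Ioo 0 τ, fracForm s (φ t) (hm.toLp _ t)
      = ∫ t in Ioo 0 τ, η t * (fracConst s / 2 * (E.κ k - 1)
          * inner ℝ (E.b k) (HsZero.toL2 s (φ t))) := by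
    refine integral_congr_ae ?_
    filter_upwards [hm.coeFn_toLp] with t ht
    rw [ht, HsZero.fracForm_eq_formOp, map_smul, E.formOp_v, smul_eq_mul]
  have e5 : ∫ t in Ioo 0 τ, ∫ x in ω, (h t) x * (hm.toLp _ t) x
      = ∫ t in Ioo 0 τ, η t * inner ℝ (E.b k) (source hωI τ h t) := by
    refine integral_congr_ae ?_
    filter_upwards [hm.coeFn_toLp, inner_source (s := s) hωI h] with t ht ht'
    rw [← ht', ht, map_smul, E.map_v, real_inner_smul_right, real_inner_comm]
  rw [e3, e4, e5] at e2
  have i3 : Integrable (fun t => η t * (fracConst s / 2 * (E.κ k - 1)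
      * inner ℝ (E.b k) (HsZero.toL2 s (φ t)))) (volume.restrict (Ioo 0 τ)) := by
    have := (integrable_smul_of_continuous h1.continuous ((HsZero.toL2 s).compLpL 2 _ φ)).const_inner
      (𝕜 := ℝ) (E.b k)
    refine (this.const_mul (fracConst s / 2 * (E.κ k - 1))).congr ?_
    filter_upwards [(HsZero.toL2 s).coeFn_compLpL (p := 2) φ] with t ht
    rw [ht, real_inner_smul_right]
    ring
  have i4 : Integrable (fun t => η t * inner ℝ (E.b k) (source hωI τ h t))
      (volume.restrict (Ioo 0 τ)) := by
    have := (integrable_smul_of_continuous h1.continuous (source hωI τ h)).const_inner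
      (𝕜 := ℝ) (E.b k)
    simpa only [real_inner_smul_right] using this
  simp only [mul_sub] at i3 ⊢
  rw [e1, integral_sub (by simpa only [mul_sub] using i3) i4]
  simp only [mul_sub] at e2
  linarith

include hωI in
/-- Every continuous representative of a state is given by the eigenfunction expansion. -/
lemma eqOn_evol_of_isState (hs0 : 0 < s) (hs1 : s < 1) (hτ : 0 < τ) (hφ : IsState s τ ω ψ h φ)
    {y : ℝ → L2I} (hy : ContinuousOn y (Icc 0 τ))
    (hyφ : ∀ᵐ r ∂(volume.restrict (Ioo 0 τ)), y r = HsZero.toL2 s (φ r)) :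
    EqOn y (E.evol (fracConst s / 2) τ ψ (source hωI τ h)) (Icc 0 τ) := by
  obtain ⟨y', hy', hyφ', hend⟩ := hφ.2
  have h1 : EqOn y y' (Icc 0 τ) := by
    refine Measure.eqOn_Icc_of_ae_eq volume hτ.ne ?_ hy hy'
    rw [← restrict_Ioo_eq_restrict_Icc]
    filter_upwards [hyφ, hyφ'] with r e1 e2
    rw [e1, e2]
  exact h1.trans (E.eq_evol ψ (source hωI τ h) (half_pos (fracConst_pos hs0 hs1)) hτ hy' hyφ' hend
    fun k η a b d => weak_coef_of_isState E hωI hφ k a b d)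

lemma isState_sol [Countable ι] (hs0 : 0 < s) (hs1 : s < 1) (hτ : 0 < τ) (ψ : L2I)
    (h : Control τ ω) :
    IsState s τ ω ψ h (E.sol ψ (source hωI τ h) (fracConst s / 2) hτ) := by
  have hc := half_pos (fracConst_pos hs0 hs1)
  set F := source hωI τ h with hF
  set φ := E.sol ψ F (fracConst s / 2) hτ with hφ
  refine ⟨⟨E.timeDeriv ψ F (fracConst s / 2) hτ, fun η h1 _ h3 =>
    E.integral_deriv_smul_sol ψ F hc hτ HsZero.toL2_injective h1 h3, fun w => ?_⟩,
    E.evol (fracConst s / 2) τ ψ F, E.continuousOn_evol ψ F hc hτ, E.evol_eq_sol ψ F hc hτ,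
    E.evol_end ψ F hc hτ⟩
  have hw := (HsZero.toL2 s).coeFn_compLpL (p := 2) w
  have i1 : Integrable (fun t => fracForm s (φ t) (w t)) (volume.restrict (Ioo 0 τ)) := by
    refine (((L2.integrable_inner (𝕜 := ℝ) φ w).sub (L2.integrable_inner (𝕜 := ℝ)
      ((HsZero.toL2 s).compLpL 2 _ φ) ((HsZero.toL2 s).compLpL 2 _ w))).const_mul
        (fracConst s / 2)).congr ?_
    filter_upwards [hw, (HsZero.toL2 s).coeFn_compLpL (p := 2) φ] with t e1 e2
    rw [HsZero.fracForm_eq_formOp, formOp_apply, Pi.sub_apply, e1, e2]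
  have i2 : Integrable (fun t => ∫ x in ω, (h t) x * (w t) x) (volume.restrict (Ioo 0 τ)) := by
    refine (L2.integrable_inner (𝕜 := ℝ) F ((HsZero.toL2 s).compLpL 2 _ w)).congr ?_
    filter_upwards [hw, inner_source (s := s) hωI h] with t e1 e2
    rw [e1, e2]
  have e : ∫ t in Ioo 0 τ, (E.timeDeriv ψ F (fracConst s / 2) hτ t) (w t)
      = (∫ t in Ioo 0 τ, fracForm s (φ t) (w t)) - ∫ t in Ioo 0 τ, ∫ x in ω, (h t) x * (w t) x := by
    rw [← integral_sub i1 i2]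
    refine integral_congr_ae ?_
    filter_upwards [E.coeFn_timeDeriv ψ F (fracConst s / 2) hτ, inner_source (s := s) hωI h]
      with t e1 e2
    rw [e1, sub_apply, pivotOp_apply, HsZero.fracForm_eq_formOp, ← e2]
  rw [e]
  ring

include hωI E in
lemma isState_unique (hs0 : 0 < s) (hs1 : s < 1) (hτ : 0 < τ) {φ' : L2Time τ (HsZero s)}
    (hφ : IsState s τ ω ψ h φ) (hφ' : IsState s τ ω ψ h φ') : φ = φ' := by
  obtain ⟨y, hy, hyφ, -⟩ := hφ.2
  obtain ⟨y', hy', hyφ', -⟩ := hφ'.2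
  have h1 := eqOn_evol_of_isState E hωI hs0 hs1 hτ hφ hy hyφ
  have h2 := eqOn_evol_of_isState E hωI hs0 hs1 hτ hφ' hy' hyφ'
  refine Lp.ext ?_
  filter_upwards [hyφ, hyφ', ae_restrict_mem measurableSet_Ioo] with t e1 e2 ht
  have ht' := Ioo_subset_Icc_self ht
  exact HsZero.toL2_injective (by rw [← e1, ← e2, h1 ht', h2 ht'])

lemma hasTrace_zero_iff (hs0 : 0 < s) (hs1 : s < 1) (hτ : 0 < τ) (hφ : IsState s τ ω ψ h φ)
    (v : L2I) : HasTrace s τ φ 0 v ↔ v = E.evol (fracConst s / 2) τ ψ (source hωI τ h) 0 := by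
  have h0 : (0 : ℝ) ∈ Icc 0 τ := left_mem_Icc.2 hτ.le
  constructor
  · rintro ⟨y, hy, hyφ, rfl⟩
    exact eqOn_evol_of_isState E hωI hs0 hs1 hτ hφ hy hyφ h0
  · rintro rfl
    obtain ⟨y, hy, hyφ, -⟩ := hφ.2
    exact ⟨y, hy, hyφ, eqOn_evol_of_isState E hωI hs0 hs1 hτ hφ hy hyφ h0⟩

lemma traceZero_state [Countable ι] (hs0 : 0 < s) (hs1 : s < 1) (hτ : 0 < τ) (ψ : L2I)
    (h : Control τ ω) :
    traceZero s τ (state s τ ω ψ h) = E.evol (fracConst s / 2) τ ψ (source hωI τ h) 0 := by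
  have h1 : IsState s τ ω ψ h (state s τ ω ψ h) :=
    Classical.epsilon_spec ⟨_, isState_sol E hωI hs0 hs1 hτ ψ h⟩
  have h2 := hasTrace_zero_iff E hωI hs0 hs1 hτ h1
  exact (h2 _).1 (Classical.epsilon_spec ⟨_, (h2 _).2 rfl⟩)

/-- The map `h ↦ φ(·,0)` for zero terminal datum, as a continuous linear map. -/
def traceL (hs0 : 0 < s) (hs1 : s < 1) (hτ : 0 < τ) : Control τ ω →L[ℝ] L2I :=
  LinearMap.mkContinuous
    { toFun := fun h => E.evol (fracConst s / 2) τ 0 (source hωI τ h) 0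
      map_add' := fun h k => by
        rw [map_add, ← E.evol_add 0 _ (half_pos (fracConst_pos hs0 hs1)) hτ 0 _
          (left_mem_Icc.2 hτ.le), add_zero]
      map_smul' := fun a h => by
        rw [map_smul, RingHom.id_apply, ← E.evol_smul 0 _ (half_pos (fracConst_pos hs0 hs1)) hτ a
          (left_mem_Icc.2 hτ.le), smul_zero] }
    (√(2 * τ) * ‖source hωI τ‖) fun h => by
      change ‖E.evol (fracConst s / 2) τ 0 (source hωI τ h) 0‖ ≤ _
      have h1 := E.norm_sq_evol_le 0 (source hωI τ h) (half_pos (fracConst_pos hs0 hs1)) hτ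
        (left_mem_Icc.2 hτ.le)
      have h2 : ‖E.evol (fracConst s / 2) τ 0 (source hωI τ h) 0‖
          ≤ √(2 * τ) * ‖source hωI τ h‖ := by
        refine le_of_sq_le_sq ?_ (by positivity)
        rw [mul_pow, Real.sq_sqrt (by positivity)]
        simpa [mul_assoc] using h1
      rw [mul_assoc]
      exact h2.trans (mul_le_mul_of_nonneg_left (ContinuousLinearMap.le_opNorm _ _) (by positivity))

end WellPosed

/-! ### The minimization problem -/

/-- The Tikhonov functional of a continuous linear map has exactly one minimizer: the solution of
the normal equation `x + ε S† (S x - z) = 0`, around which the functional is an exact quadratic. -/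
lemma exists_unique_minimizer {X Y : Type} [NormedAddCommGroup X] [InnerProductSpace ℝ X]
    [CompleteSpace X] [NormedAddCommGroup Y] [InnerProductSpace ℝ Y] [CompleteSpace Y]
    (S : X →L[ℝ] Y) (z : Y) {ε : ℝ} (hε : 0 < ε) :
    ∃ x₀ : X, ∀ x, (∀ k, 1 / 2 * ‖x‖ ^ 2 + ε / 2 * ‖S x - z‖ ^ 2
      ≤ 1 / 2 * ‖k‖ ^ 2 + ε / 2 * ‖S k - z‖ ^ 2) ↔ x = x₀ := by
  set B : X →L[ℝ] X →L[ℝ] ℝ := (innerSL ℝ).comp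
    (ContinuousLinearMap.id ℝ X + ε • (ContinuousLinearMap.adjoint S).comp S) with hB
  have hBa : ∀ v w, B v w = inner ℝ v w + ε * inner ℝ (S v) (S w) := fun v w => by
    rw [← ContinuousLinearMap.adjoint_inner_left, ← real_inner_smul_left, ← inner_add_left]
    rfl
  have hco : IsCoercive B := ⟨1, one_pos, fun v => by
    rw [hBa, real_inner_self_eq_norm_sq, real_inner_self_eq_norm_sq]
    nlinarith [mul_nonneg hε.le (sq_nonneg ‖S v‖)]⟩
  set x₀ := hco.continuousLinearEquivOfBilin.symm (ε • ContinuousLinearMap.adjoint S z) with hx₀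
  have hn : ∀ w, inner ℝ x₀ w + ε * inner ℝ (S x₀) (S w) = ε * inner ℝ z (S w) := fun w => by
    rw [← hBa, ← hco.continuousLinearEquivOfBilin_apply, hx₀,
      ContinuousLinearEquiv.apply_symm_apply, real_inner_smul_left,
      ContinuousLinearMap.adjoint_inner_left]
  have hq : ∀ x, 1 / 2 * ‖x‖ ^ 2 + ε / 2 * ‖S x - z‖ ^ 2
      = 1 / 2 * ‖x₀‖ ^ 2 + ε / 2 * ‖S x₀ - z‖ ^ 2
        + (1 / 2 * ‖x - x₀‖ ^ 2 + ε / 2 * ‖S (x - x₀)‖ ^ 2) := fun x => by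
    obtain ⟨d, rfl⟩ : ∃ d, x = x₀ + d := ⟨x - x₀, by abel⟩
    have h1 : S (x₀ + d) - z = (S x₀ - z) + S d := by rw [map_add]; abel
    rw [h1, norm_add_sq_real, norm_add_sq_real, add_sub_cancel_left, inner_sub_left]
    linarith [hn d]
  refine ⟨x₀, fun x => ⟨fun h => ?_, ?_⟩⟩
  · have h1 := h x₀
    rw [hq x] at h1
    have h2 : ‖x - x₀‖ ^ 2 ≤ 0 := by nlinarith [mul_nonneg hε.le (sq_nonneg ‖S (x - x₀)‖)]
    have h3 : ‖x - x₀‖ = 0 := by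
      rw [← sq_eq_zero_iff]
      exact le_antisymm h2 (sq_nonneg _)
    exact sub_eq_zero.1 (norm_eq_zero.1 h3)
  · rintro rfl k
    rw [hq k]
    have : 0 ≤ 1 / 2 * ‖k - x₀‖ ^ 2 + ε / 2 * ‖S (k - x₀)‖ ^ 2 := by positivity
    linarith

end

end FracHUM

theorem theorem4p1 (s : ℝ) (hs0 : 0 < s) (hs1 : s < 1) (τ : ℝ) (hτ : 0 < τ)
    (ω : Set ℝ) (hω : MeasurableSet ω) (hωI : ω ⊆ Set.Ioo (-1 : ℝ) 1)
    (φ₀ : FracHUM.L2I) (ε : ℝ) (hε : 0 < ε) :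
    -- the control problem is well posed: each control has exactly one state, and that state
    -- has exactly one value at time 0
    (∀ (ψ₀ : FracHUM.L2I) (h : FracHUM.Control τ ω),
      (∃! φ, FracHUM.IsState s τ ω ψ₀ h φ) ∧
      ∀ φ, FracHUM.IsState s τ ω ψ₀ h φ → ∃! v, FracHUM.HasTrace s τ φ 0 v) ∧
    -- the reduced and the original problem have one and the same minimizer, and no other one
    ∃ hbar : FracHUM.Control τ ω,
      (∀ h : FracHUM.Control τ ω,
        (∀ k, FracHUM.reducedJ s τ ω φ₀ ε h ≤ FracHUM.reducedJ s τ ω φ₀ ε k) ↔ h = hbar) ∧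
      (∀ h : FracHUM.Control τ ω,
        (∀ k, FracHUM.J s τ ω φ₀ ε h ≤ FracHUM.J s τ ω φ₀ ε k) ↔ h = hbar) := by
  open FracHUM in
  obtain ⟨ι, ⟨E⟩⟩ := HsZero.exists_eigenBasis hs0 hs1
  -- Separability of `L²(-1,1)` is found by instance search from this fact.
  have : Fact ((2 : ENNReal) ≠ ⊤) := ⟨by simp⟩
  have : Countable ι := countable_of_hilbertBasis E.b
  refine ⟨fun ψ₀ h => ⟨⟨_, isState_sol E hωI hs0 hs1 hτ ψ₀ h, fun φ' hφ' =>
    isState_unique E hωI hs0 hs1 hτ hφ' (isState_sol E hωI hs0 hs1 hτ ψ₀ h)⟩, fun φ hφ =>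
    ⟨_, (hasTrace_zero_iff E hωI hs0 hs1 hτ hφ _).2 rfl, fun v hv =>
      (hasTrace_zero_iff E hωI hs0 hs1 hτ hφ v).1 hv⟩⟩, ?_⟩
  have hS : ∀ h, controlToTrace s τ ω h = traceL E hωI hs0 hs1 hτ h := fun h =>
    traceZero_state E hωI hs0 hs1 hτ 0 h
  -- By superposition `φ(·,0) = S h - z`.
  have hJ : ∀ h, J s τ ω φ₀ ε h = reducedJ s τ ω φ₀ ε h := fun h => by
    have h1 := E.evol_add 0 (source hωI τ h) (half_pos (fracConst_pos hs0 hs1)) hτ φ₀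
      (source hωI τ 0) (Set.left_mem_Icc.2 hτ.le)
    rw [← map_add, zero_add, add_zero] at h1
    rw [J, reducedJ, controlToTrace, target, sub_neg_eq_add,
      traceZero_state E hωI hs0 hs1 hτ, traceZero_state E hωI hs0 hs1 hτ,
      traceZero_state E hωI hs0 hs1 hτ, h1]
  obtain ⟨hbar, hmin⟩ := exists_unique_minimizer (traceL E hωI hs0 hs1 hτ) (target s τ ω φ₀) hε
  have hred : ∀ h, (∀ k, reducedJ s τ ω φ₀ ε h ≤ reducedJ s τ ω φ₀ ε k) ↔ h = hbar := fun h => by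
    simp only [reducedJ, hS]
    exact hmin h
  exact ⟨hbar, hred, fun h => by simpa only [hJ] using hred h⟩
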